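/- Let $R=\mathbb{C}[x_0,\dots,x_n]$ with its usual grading, and let $f\in R$ be a homogeneous polynomial of degree $d$ which is reduced (nonzero and without multiple factors), with associated hypersurface $V(f)\subset\mathbb{P}^n$. For an integer $0\le k\le d$ let $J^k(f)\subset R$ be the homogeneous ideal generated by all the $k$-th order partial derivatives of $f$, and let $M^k(f)=R/J^k(f)$ be the $k$-th order Milnor algebra of $f$. (1) The algebra $M^k(f)$ is Artinian if and only if the multiplicity of $V(f)$ at every point $p\in V(f)$ is at most $k$. Here the multiplicity of $V(f)$ at $p$ is the order of vanishing at $p$ of a local equation of $V(f)$. (2) Suppose that $k\ge 1$ and that $V(f)$ has only isolated singularities, i.e. its singular locus is a finite (possibly empty) set of pairwise distinct points $p_1,\dots,p_s$. Then the $k$-th order Tjurina numbers $\tau^k(V(f),p_i)$ are finite, and there is an $m_0$ such that for all $m\ge m_0$ $$\dim_{\mathbb{C}} M^k(f)_m=\sum_{i=1}^s\tau^k(V(f),p_i).$$ Here, if $g\in\mathcal{O}_n=\mathbb{C}\{y_1,\dots,y_n\}$ is a local equation of $V(f)$ at $p$, in affine coordinates $y_1,\dots,y_n$ centred at $p$,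 then $\tau^k(V(f),p)=\dim_{\mathbb{C}}\mathcal{O}_n/TI^k(g)$, where $TI^k(g)$ is the ideal of $\mathcal{O}_n$ generated by all the partial derivatives $\partial^\alpha g$ with $0\le|\alpha|\le k$. -/

import Mathlib

open scoped LinearAlgebra.Projectivization

noncomputable section

namespace HigherMilnor

/-! ### Higher order Jacobian ideals and Milnor algebras -/

/-- The ideal `J^k(f)` generated by all the partial derivatives of `f` of order exactly `k`.
A list `[i₁, …, iₖ]` of indices encodes the operator `∂_{i₁} ⋯ ∂_{iₖ}`. -/
def jacobianIdeal {n : ℕ} (k : ℕ) (f : MvPolynomial (Fin (n + 1)) ℂ) :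
    Ideal (MvPolynomial (Fin (n + 1)) ℂ) :=
  Ideal.span {h | ∃ l : List (Fin (n + 1)), l.length = k ∧
    h = l.foldr (fun i g => MvPolynomial.pderiv i g) f}

/-- The `k`-th order Milnor algebra `M^k(f) = R / J^k(f)`. -/
abbrev MilnorAlgebra {n : ℕ} (k : ℕ) (f : MvPolynomial (Fin (n + 1)) ℂ) : Type :=
  MvPolynomial (Fin (n + 1)) ℂ ⧸ jacobianIdeal k f

/-- The graded piece `M^k(f)_m`: the image in `M^k(f)` of the forms of degree `m`. -/
def milnorPiece {n : ℕ} (k : ℕ) (f : MvPolynomial (Fin (n + 1)) ℂ) (m : ℕ) :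
    Submodule ℂ (MilnorAlgebra k f) :=
  (MvPolynomial.homogeneousSubmodule (Fin (n + 1)) ℂ m).map
    (Ideal.Quotient.mkₐ ℂ (jacobianIdeal k f)).toLinearMap

/-! ### The projective hypersurface and its singular points -/

/-- The complex projective space `ℙⁿ`. -/
abbrev ProjSpace (n : ℕ) : Type := ℙ ℂ (Fin (n + 1) → ℂ)

/-- The set of points of the hypersurface `V(f)`, for `f` homogeneous. -/
def hypersurface {n : ℕ} (f : MvPolynomial (Fin (n + 1)) ℂ) : Set (ProjSpace n) :=
  {p | MvPolynomial.eval p.rep f = 0}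

/-- The singular points of the hypersurface `V(f)`, for `f` homogeneous: the points of `V(f)` at
which all the first order partial derivatives of `f` vanish. -/
def singularLocus {n : ℕ} (f : MvPolynomial (Fin (n + 1)) ℂ) : Set (ProjSpace n) :=
  {p | p ∈ hypersurface f ∧
    ∀ i, MvPolynomial.eval p.rep (MvPolynomial.pderiv i f) = 0}

theorem exists_rep_ne_zero {n : ℕ} (p : ProjSpace n) : ∃ i, p.rep i ≠ 0 :=
  Function.ne_iff.mp p.rep_nonzero

/-- An index `i` such that the point `p` lies in the affine chart `x_i ≠ 0`. -/
def chartIndex {n : ℕ} (p : ProjSpace n) : Fin (n + 1) :=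
  (exists_rep_ne_zero p).choose

theorem rep_chartIndex_ne_zero {n : ℕ} (p : ProjSpace n) : p.rep (chartIndex p) ≠ 0 :=
  (exists_rep_ne_zero p).choose_spec

/-- The local equation of `V(f)` at `p`: in the affine chart `x_i = 1` around `p`, with the affine
coordinates `y` translated so that `p` is the origin, it is
`g(y) = f(a₀ + y₀, …, 1, …, a_{n-1} + y_{n-1})`, where `1` stands in position `i` and `a` are the
affine coordinates of `p`. -/
def localEquation {n : ℕ} (f : MvPolynomial (Fin (n + 1)) ℂ) (p : ProjSpace n) :
    MvPolynomial (Fin n) ℂ :=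
  MvPolynomial.aeval
    ((chartIndex p).insertNth (α := fun _ => MvPolynomial (Fin n) ℂ) 1 fun j : Fin n =>
      MvPolynomial.C (p.rep ((chartIndex p).succAbove j) / p.rep (chartIndex p)) +
        MvPolynomial.X j) f

/-! ### The local ring of germs of holomorphic functions at the origin of `ℂⁿ` -/

/-- A formal power series in `n` variables over `ℂ` converges in a neighbourhood of the origin iff
its coefficients grow at most geometrically in the total degree. -/
def IsConvergent {n : ℕ} (g : MvPowerSeries (Fin n) ℂ) : Prop :=
  ∃ C K : ℝ, 0 < C ∧ 0 < K ∧ ∀ α : Fin n →₀ ℕ, ‖MvPowerSeries.coeff α g‖ ≤ C * K ^ α.degree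

theorem isConvergent_coe {n : ℕ} (g : MvPolynomial (Fin n) ℂ) :
    IsConvergent (g : MvPowerSeries (Fin n) ℂ) := by
  have h0 : 0 ≤ ∑ β ∈ g.support, ‖g.coeff β‖ := Finset.sum_nonneg fun _ _ => norm_nonneg _
  refine ⟨∑ β ∈ g.support, ‖g.coeff β‖ + 1, 1, by linarith, one_pos, fun α => ?_⟩
  rw [MvPolynomial.coeff_coe, one_pow, mul_one]
  by_cases h : α ∈ g.support
  · have := Finset.single_le_sum (f := fun β => ‖g.coeff β‖) (fun _ _ => norm_nonneg _) h
    linarith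
  · rw [MvPolynomial.notMem_support_iff.mp h, norm_zero]
    linarith

theorem IsConvergent.add {n : ℕ} {g h : MvPowerSeries (Fin n) ℂ} (hg : IsConvergent g)
    (hh : IsConvergent h) : IsConvergent (g + h) := by
  obtain ⟨C, K, hC, hK, H⟩ := hg
  obtain ⟨C', K', hC', hK', H'⟩ := hh
  refine ⟨C + C', max K K', by positivity, by positivity, fun α => ?_⟩
  rw [map_add, add_mul]
  refine (norm_add_le _ _).trans (add_le_add ((H α).trans ?_) ((H' α).trans ?_))
  · gcongr
    exact le_max_left _ _
  · gcongr
    exact le_max_right _ _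

theorem card_antidiagonal_le {n : ℕ} (α : Fin n →₀ ℕ) :
    (Finset.HasAntidiagonal.antidiagonal α).card ≤ 2 ^ α.degree := by
  have h1 : (Finset.HasAntidiagonal.antidiagonal α).card ≤ (Finset.Iic α).card := by
    refine Finset.card_le_card_of_injOn Prod.fst (fun x hx => ?_) (fun x hx y hy hxy => ?_)
    · have := Finset.HasAntidiagonal.mem_antidiagonal.mp hx
      simp [← this]
    · have hx' := Finset.HasAntidiagonal.mem_antidiagonal.mp hx
      have hy' := Finset.HasAntidiagonal.mem_antidiagonal.mp hy
      refine Prod.ext hxy (add_left_cancel (a := x.1) ?_)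
      rw [hx', hxy, hy']
  refine h1.trans ?_
  rw [Finsupp.card_Iic, Finsupp.degree_apply, ← Finset.prod_pow_eq_pow_sum]
  refine Finset.prod_le_prod' fun i _ => ?_
  rw [Nat.card_Iic]
  exact Nat.lt_two_pow_self

theorem IsConvergent.mul {n : ℕ} {g h : MvPowerSeries (Fin n) ℂ} (hg : IsConvergent g)
    (hh : IsConvergent h) : IsConvergent (g * h) := by
  obtain ⟨C, K, hC, hK, H⟩ := hg
  obtain ⟨C', K', hC', hK', H'⟩ := hh
  refine ⟨C * C', 2 * max K K', by positivity, by positivity, fun α => ?_⟩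
  rw [MvPowerSeries.coeff_mul]
  have key : ∀ x ∈ Finset.HasAntidiagonal.antidiagonal α,
      ‖MvPowerSeries.coeff x.1 g * MvPowerSeries.coeff x.2 h‖ ≤
        C * C' * (max K K') ^ α.degree := by
    intro x hx
    rw [norm_mul, ← Finset.HasAntidiagonal.mem_antidiagonal.mp hx, map_add, pow_add]
    calc _ ≤ (C * K ^ x.1.degree) * (C' * K' ^ x.2.degree) := by
            gcongr
            · exact H _
            · exact H' _
      _ ≤ (C * (max K K') ^ x.1.degree) * (C' * (max K K') ^ x.2.degree) := by
            gcongr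
            · exact le_max_left _ _
            · exact le_max_right _ _
      _ = _ := by ring
  refine (norm_sum_le_of_le _ key).trans ?_
  rw [Finset.sum_const, nsmul_eq_mul, mul_pow]
  have hc : ((Finset.HasAntidiagonal.antidiagonal α).card : ℝ) ≤ 2 ^ α.degree := by
    exact_mod_cast card_antidiagonal_le α
  calc _ ≤ (2 : ℝ) ^ α.degree * (C * C' * (max K K') ^ α.degree) := by gcongr
    _ = _ := by ring

theorem IsConvergent.pderiv {n : ℕ} {g : MvPowerSeries (Fin n) ℂ} (hg : IsConvergent g)
    (i : Fin n) : IsConvergent (MvPowerSeries.pderiv ℂ i g) := by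
  obtain ⟨C, K, hC, hK, H⟩ := hg
  refine ⟨C * K, 2 * K, by positivity, by positivity, fun α => ?_⟩
  rw [MvPowerSeries.coeff_pderiv, norm_mul]
  have h1 : ‖((α i : ℂ) + 1)‖ ≤ 2 ^ α.degree := by
    have h2 : α i + 1 ≤ 2 ^ α.degree :=
      (Nat.lt_two_pow_self (n := α i)).trans_le
        (Nat.pow_le_pow_right two_pos (Finsupp.le_degree i α))
    have h3 : ((α i : ℂ) + 1) = ((α i + 1 : ℕ) : ℂ) := by push_cast; rfl
    rw [h3, Complex.norm_natCast]
    exact_mod_cast h2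
  calc _ ≤ (C * K ^ (α + Finsupp.single i 1).degree) * 2 ^ α.degree := by
          gcongr
          exact H _
    _ = _ := by
          rw [map_add, Finsupp.degree_single, pow_add, mul_pow]
          ring

/-- The local ring `𝒪ₙ` of germs of holomorphic functions at the origin of `ℂⁿ`, as the ring
`ℂ{y₁, …, yₙ}` of convergent power series. -/
def convergentPowerSeries (n : ℕ) : Subalgebra ℂ (MvPowerSeries (Fin n) ℂ) where
  carrier := {g | IsConvergent g}
  mul_mem' := IsConvergent.mul
  add_mem' := IsConvergent.add
  algebraMap_mem' c := by
    have h := isConvergent_coe (MvPolynomial.C c : MvPolynomial (Fin n) ℂ)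
    rwa [MvPolynomial.coe_C] at h

/-- The partial derivative `∂/∂y_i` on `𝒪ₙ`. -/
def germPderiv {n : ℕ} (i : Fin n) (g : convergentPowerSeries n) : convergentPowerSeries n :=
  ⟨MvPowerSeries.pderiv ℂ i g, IsConvergent.pderiv g.2 i⟩

/-! ### Higher order Tjurina algebras -/

/-- The `k`-th order Tjurina ideal of `g ∈ 𝒪ₙ`, generated by all the partial derivatives of `g` of
order at most `k` (including `g` itself). -/
def tjurinaIdeal {n : ℕ} (k : ℕ) (g : convergentPowerSeries n) :
    Ideal (convergentPowerSeries n) :=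
  Ideal.span {h | ∃ l : List (Fin n), l.length ≤ k ∧ h = l.foldr germPderiv g}

/-- The `k`-th order Tjurina algebra of the germ `g = 0`. -/
abbrev TjurinaAlgebra {n : ℕ} (k : ℕ) (g : convergentPowerSeries n) : Type :=
  convergentPowerSeries n ⧸ tjurinaIdeal k g

/-- The germ at the origin of `ℂⁿ` of the local equation of `V(f)` at `p`. -/
def localGerm {n : ℕ} (f : MvPolynomial (Fin (n + 1)) ℂ) (p : ProjSpace n) :
    convergentPowerSeries n :=
  ⟨(localEquation f p : MvPowerSeries (Fin n) ℂ), isConvergent_coe _⟩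

/-- The multiplicity of the hypersurface `V(f)` at `p`: the lowest degree of a monomial occurring
in the local equation of `V(f)` at `p`. -/
def hypersurfaceMultiplicity {n : ℕ} (f : MvPolynomial (Fin (n + 1)) ℂ) (p : ProjSpace n) : ℕ∞ :=
  MvPowerSeries.order (localGerm f p : MvPowerSeries (Fin n) ℂ)

/-- The `k`-th order Tjurina number `τ^k(V(f), p)`. -/
def tjurinaNumber {n : ℕ} (k : ℕ) (f : MvPolynomial (Fin (n + 1)) ℂ) (p : ProjSpace n) : ℕ :=
  Module.finrank ℂ (TjurinaAlgebra k (localGerm f p))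

end HigherMilnor

end

/-! Write `J` for `jacobianIdeal k f`. In characteristic zero with `k ≤ d`, Euler's identity puts
all derivatives of order at most `k` into `J`, and in a chart `x_c = 1` it eliminates `∂_c`. Hence
dehomogenizing `J` at a point `p` gives exactly the ideal of derivatives of order at most `k` of the
local equation (`map_dehomogenize_jacobianIdeal`).

Part (1): by Taylor expansion the projective zeros of `J` are the points of multiplicity greater
than `k`, all of them on `V(f)`. A graded quotient of the polynomial ring is Artinian iff its ideal
has no projective zero (`isArtinianRing_quotient_iff`).

Part (2): for `k ≥ 1` the projective zeros of `J` are among the singular points. Choose a linear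
form `g` vanishing at none of these. Then `J + (g)` contains all forms of large degree, so the
Hilbert function of `R/J` is eventually `dim R/(J + (g - 1))` (`exists_finrank_graded_piece_eq`).
The Chinese remainder theorem splits this algebra into pieces `R/(J + I_p^N + (g - 1))`, with `I_p`
the ideal of the line over `p`. Applying the same Hilbert function result to `J + I_p^N` lets `g` be
replaced by the chart coordinate `x_c` (`exists_finrank_piece_eq_sum`). Dehomogenizing yields
polynomials modulo the Tjurina ideal plus a power of the maximal ideal; for large `N` this is the
Tjurina algebra of germs (`nonempty_quotient_map_polynomialGerm_equiv`). -/

noncomputable section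

namespace HigherMilnor

open MvPolynomial

/-! ### Hilbert functions of graded quotients and dehomogenization by a linear form -/

section Graded

attribute [local instance] MvPolynomial.gradedAlgebra

variable {σ K : Type*} [Field K]

theorem homogeneousComponent_mul_of_isHomogeneous {l : MvPolynomial σ K} {i : ℕ}
    (hl : l.IsHomogeneous i) (b : MvPolynomial σ K) (j : ℕ) :
    homogeneousComponent (i + j) (l * b) = l * homogeneousComponent j b := by
  have h := DirectSum.coe_decompose_mul_add_of_left_mem (homogeneousSubmodule σ K) (j := j) (b := b)
    ((mem_homogeneousSubmodule i l).mpr hl)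
  rwa [← decomposition.decompose'_apply, ← decomposition.decompose'_apply]

theorem isHomogeneous_span_forms {s : Set (MvPolynomial σ K)}
    (hs : ∀ F ∈ s, ∃ i, F.IsHomogeneous i) :
    (Ideal.span s).IsHomogeneous (homogeneousSubmodule σ K) :=
  Ideal.homogeneous_span _ _ fun F hF => hs F hF

theorem isHomogeneous_ideal_pow {I : Ideal (MvPolynomial σ K)}
    (hI : I.IsHomogeneous (homogeneousSubmodule σ K)) (N : ℕ) :
    (I ^ N).IsHomogeneous (homogeneousSubmodule σ K) := by
  induction N with
  | zero => rw [pow_zero, Ideal.one_eq_top]; exact Ideal.IsHomogeneous.top _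
  | succ N ih => rw [pow_succ]; exact ih.mul hI

/-- A form that lies in `H + (l)` equals `l` times a form, up to an element of `H`. -/
theorem exists_form_sub_mul_mem {H : Ideal (MvPolynomial σ K)}
    (hH : H.IsHomogeneous (homogeneousSubmodule σ K)) {l : MvPolynomial σ K}
    (hl : l.IsHomogeneous 1) {F : MvPolynomial σ K} {m : ℕ} (hF : F.IsHomogeneous (1 + m))
    (hFl : F ∈ H ⊔ Ideal.span {l}) :
    ∃ G : MvPolynomial σ K, G.IsHomogeneous m ∧ F - l * G ∈ H := by
  obtain ⟨h, hh, b, hb, rfl⟩ := Submodule.mem_sup.mp hFl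
  obtain ⟨b, rfl⟩ := Ideal.mem_span_singleton.mp hb
  refine ⟨homogeneousComponent m b, homogeneousComponent_isHomogeneous _ _, ?_⟩
  rw [← homogeneousComponent_mul_of_isHomogeneous hl, ← homogeneousComponent_eq_self hF, map_add]
  simpa using homogeneousComponent_mem_of_mem hH hh (1 + m)

theorem pow_mul_sub_self_mem (H : Ideal (MvPolynomial σ K)) (l F : MvPolynomial σ K) (j : ℕ) :
    l ^ j * F - F ∈ H ⊔ Ideal.span {l - 1} := by
  refine Ideal.mem_sup_right ?_
  have : l ^ j * F - F = (l ^ j - 1) * F := by ring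
  rw [this]
  exact Ideal.mul_mem_right _ _ (Ideal.mem_span_singleton.mpr (sub_one_dvd_pow_sub_one l j))

/-- A form of large degree is `l * G` modulo `H`, and `l` is `1` modulo `l - 1`, so the degree can
be lowered one step at a time. -/
theorem exists_form_sub_mem_of_le {H : Ideal (MvPolynomial σ K)}
    (hH : H.IsHomogeneous (homogeneousSubmodule σ K)) {l : MvPolynomial σ K}
    (hl : l.IsHomogeneous 1) {m₁ : ℕ}
    (hm : ∀ m ≥ m₁, ∀ F : MvPolynomial σ K, F.IsHomogeneous m → F ∈ H ⊔ Ideal.span {l})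
    {m : ℕ} (hmm : m₁ ≤ m) (t : ℕ) (F : MvPolynomial σ K) (hF : F.IsHomogeneous (m + t)) :
    ∃ G : MvPolynomial σ K, G.IsHomogeneous m ∧ F - G ∈ H ⊔ Ideal.span {l - 1} := by
  induction t generalizing F with
  | zero => exact ⟨F, hF, by simp⟩
  | succ t ih =>
    obtain ⟨G, hG, hFG⟩ := exists_form_sub_mul_mem hH hl (m := m + t) (F := F)
      (by rwa [show 1 + (m + t) = m + (t + 1) by ring]) (hm (m + (t + 1)) (by lia) F hF)
    obtain ⟨G', hG', hGG⟩ := ih G hG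
    refine ⟨G', hG', ?_⟩
    have h1 := pow_mul_sub_self_mem H l G 1
    have h2 : F - G' = (F - l * G) + (l ^ 1 * G - G) + (G - G') := by ring
    rw [h2]
    exact add_mem (add_mem (Ideal.mem_sup_left hFG) h1) hGG

/-- Modulo `H + (l - 1)` every polynomial is a form of any prescribed large degree. -/
theorem exists_form_sub_mem {H : Ideal (MvPolynomial σ K)}
    (hH : H.IsHomogeneous (homogeneousSubmodule σ K)) {l : MvPolynomial σ K}
    (hl : l.IsHomogeneous 1) {m₁ : ℕ}
    (hm : ∀ m ≥ m₁, ∀ F : MvPolynomial σ K, F.IsHomogeneous m → F ∈ H ⊔ Ideal.span {l})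
    {m : ℕ} (hmm : m₁ ≤ m) (F : MvPolynomial σ K) :
    ∃ G : MvPolynomial σ K, G.IsHomogeneous m ∧ F - G ∈ H ⊔ Ideal.span {l - 1} := by
  have key : ∀ i, ∃ G : MvPolynomial σ K, G.IsHomogeneous m ∧
      homogeneousComponent i F - G ∈ H ⊔ Ideal.span {l - 1} := by
    intro i
    have hi := homogeneousComponent_isHomogeneous i F
    rcases le_total i m with h | h
    · refine ⟨l ^ (m - i) * homogeneousComponent i F, ?_, ?_⟩
      · have := (hl.pow (m - i)).mul hi
        rwa [one_mul, Nat.sub_add_cancel h] at this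
      · have := neg_mem (pow_mul_sub_self_mem H l (homogeneousComponent i F) (m - i))
        rwa [neg_sub] at this
    · obtain ⟨t, rfl⟩ := Nat.exists_eq_add_of_le h
      exact exists_form_sub_mem_of_le hH hl hm hmm t _ hi
  choose G hG hFG using key
  refine ⟨∑ i ∈ Finset.range (F.totalDegree + 1), G i, IsHomogeneous.sum _ _ _ fun i _ => hG i, ?_⟩
  have h : F - ∑ i ∈ Finset.range (F.totalDegree + 1), G i =
      ∑ i ∈ Finset.range (F.totalDegree + 1), (homogeneousComponent i F - G i) := by
    rw [Finset.sum_sub_distrib, sum_homogeneousComponent]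
  rw [h]
  exact Ideal.sum_mem _ fun i _ => hFG i

theorem homogeneousComponent_of_totalDegree_lt {F : MvPolynomial σ K} {m : ℕ}
    (h : F.totalDegree < m) : homogeneousComponent m F = 0 :=
  homogeneousComponent_eq_zero _ _ h

/-- Multiplication by `l` is injective on `R / H` in large degrees. -/
theorem exists_forall_mem_of_mul_mem [Finite σ] {H : Ideal (MvPolynomial σ K)}
    (hH : H.IsHomogeneous (homogeneousSubmodule σ K)) {l : MvPolynomial σ K} {m₁ : ℕ}
    (hm : ∀ m ≥ m₁, ∀ F : MvPolynomial σ K, F.IsHomogeneous m → F ∈ H ⊔ Ideal.span {l}) :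
    ∃ m₀, ∀ m ≥ m₀, ∀ F : MvPolynomial σ K, F.IsHomogeneous m → l * F ∈ H → F ∈ H := by
  classical
  -- The colon ideal `(H : l)`. It has finitely many generators `g`, and each satisfies `l * g ∈ H`.
  let C : Ideal (MvPolynomial σ K) :=
    Submodule.comap (LinearMap.mulLeft (MvPolynomial σ K) l) H
  have hC : ∀ F, F ∈ C ↔ l * F ∈ H := fun F => Iff.rfl
  obtain ⟨s, hs⟩ := (IsNoetherian.noetherian C : C.FG)
  refine ⟨m₁ + s.sup totalDegree + 1, fun m hmm F hF hlF => ?_⟩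
  have hFC : F ∈ Submodule.span (MvPolynomial σ K) (s : Set (MvPolynomial σ K)) := by
    rw [hs]; exact hlF
  obtain ⟨a, -, ha⟩ := Submodule.mem_span_finset.mp hFC
  have hmem : ∀ g ∈ s, homogeneousComponent m (a g * g) ∈ H := by
    intro g hg
    have hgC : l * g ∈ H := by
      rw [← hC, ← hs]
      exact Submodule.subset_span hg
    rw [← sum_homogeneousComponent (a g), Finset.sum_mul, map_sum]
    refine Ideal.sum_mem _ fun i _ => ?_
    -- Coefficients of degree at least `m₁` lie in `H + (l)`, so they multiply `g` into `H`. Those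
    -- of smaller degree give products of degree below `m`, which do not contribute.
    by_cases hi : m₁ ≤ i
    · refine homogeneousComponent_mem_of_mem hH ?_ m
      obtain ⟨h, hh, b, hb, hhb⟩ := Submodule.mem_sup.mp
        (hm i hi _ (homogeneousComponent_isHomogeneous i (a g)))
      obtain ⟨b, rfl⟩ := Ideal.mem_span_singleton.mp hb
      rw [← hhb, add_mul, mul_right_comm]
      exact add_mem (Ideal.mul_mem_right _ _ hh) (Ideal.mul_mem_right _ _ hgC)
    · have h1 : (homogeneousComponent i (a g) * g).totalDegree < m := by
        have h2 := totalDegree_mul (homogeneousComponent i (a g)) g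
        have h3 := (homogeneousComponent_isHomogeneous i (a g)).totalDegree_le
        have h4 := Finset.le_sup (f := totalDegree) hg
        lia
      rw [homogeneousComponent_of_totalDegree_lt h1]
      exact zero_mem _
  rw [← homogeneousComponent_eq_self hF, ← ha, map_sum]
  exact Ideal.sum_mem _ hmem

/-- In large degrees, a form that lies in `H + (l - 1)` already lies in `H`. -/
theorem exists_forall_mem_of_mem_sup_sub_one [Finite σ] {H : Ideal (MvPolynomial σ K)}
    (hH : H.IsHomogeneous (homogeneousSubmodule σ K)) {l : MvPolynomial σ K}
    (hl : l.IsHomogeneous 1) {m₁ : ℕ}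
    (hm : ∀ m ≥ m₁, ∀ F : MvPolynomial σ K, F.IsHomogeneous m → F ∈ H ⊔ Ideal.span {l}) :
    ∃ m₀, ∀ m ≥ m₀, ∀ F : MvPolynomial σ K, F.IsHomogeneous m →
      F ∈ H ⊔ Ideal.span {l - 1} → F ∈ H := by
  obtain ⟨m₀, hm₀⟩ := exists_forall_mem_of_mul_mem hH hm
  refine ⟨m₀, fun m hmm F hF hFl => ?_⟩
  obtain ⟨h, hh, b, hb, hhb⟩ := Submodule.mem_sup.mp hFl
  obtain ⟨b, rfl⟩ := Ideal.mem_span_singleton.mp hb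
  have comp : ∀ j, homogeneousComponent (1 + j) F = homogeneousComponent (1 + j) h +
      l * homogeneousComponent j b - homogeneousComponent (1 + j) b := by
    intro j
    rw [← hhb, map_add, sub_mul, map_sub, one_mul, homogeneousComponent_mul_of_isHomogeneous hl,
      add_sub_assoc]
  -- With `F = h + b(l - 1)` and `F` concentrated in degree `m`, the recursion `b_{j+1} = h_{j+1} +
  -- l b_j` propagates membership upwards from degree `0`.
  have low : ∀ j < m, homogeneousComponent j b ∈ H := by
    intro j
    induction j with
    | zero =>
      intro hj
      have h0 : homogeneousComponent 0 F = 0 := by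
        rw [homogeneousComponent_of_mem ((mem_homogeneousSubmodule _ _).mpr hF), if_neg hj.ne]
      have h1 : homogeneousComponent 0 (l * b) = 0 := by
        have hl0 : coeff 0 l = 0 := hl.coeff_eq_zero (by simp)
        rw [homogeneousComponent_zero, ← constantCoeff_eq, map_mul, constantCoeff_eq, hl0, zero_mul,
          C_0]
      have h2 : homogeneousComponent 0 b = homogeneousComponent 0 h := by
        have : homogeneousComponent 0 F =
            homogeneousComponent 0 h + homogeneousComponent 0 (l * b)
              - homogeneousComponent 0 b := by
          rw [← hhb, ← map_add, ← map_sub]; congr 1; ring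
        rw [h0, h1, add_zero] at this
        exact (sub_eq_zero.mp this.symm).symm
      rw [h2]
      exact homogeneousComponent_mem_of_mem hH hh 0
    | succ j ih =>
      intro hj
      have h0 : homogeneousComponent (1 + j) F = 0 := by
        rw [homogeneousComponent_of_mem ((mem_homogeneousSubmodule _ _).mpr hF), if_neg (by lia)]
      have h1 := comp j
      rw [h0] at h1
      rw [add_comm j 1, ← sub_eq_zero.mp h1.symm]
      exact add_mem (homogeneousComponent_mem_of_mem hH hh _)
        (Ideal.mul_mem_left _ _ (ih (by lia)))
  -- From degree `m` on, the same recursion is run downwards from above the degree of `b`: `l b_j ∈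
  -- H` implies `b_j ∈ H` by injectivity of `l` in large degrees.
  have high : ∀ t j, m ≤ j → b.totalDegree < j + t → homogeneousComponent j b ∈ H := by
    intro t
    induction t with
    | zero =>
      intro j _ hj
      rw [homogeneousComponent_of_totalDegree_lt (by lia)]
      exact zero_mem _
    | succ t ih =>
      intro j hj hjt
      refine hm₀ j (hmm.trans hj) _ (homogeneousComponent_isHomogeneous j b) ?_
      have h0 : homogeneousComponent (1 + j) F = 0 := by
        rw [homogeneousComponent_of_mem ((mem_homogeneousSubmodule _ _).mpr hF), if_neg (by lia)]
      have h1 := comp j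
      rw [h0] at h1
      have h2 : l * homogeneousComponent j b =
          homogeneousComponent (1 + j) b - homogeneousComponent (1 + j) h := by
        linear_combination -h1
      rw [h2]
      exact sub_mem (ih (1 + j) (by lia) (by lia)) (homogeneousComponent_mem_of_mem hH hh _)
  have hbH : b ∈ H := by
    rw [mem_iff_homogeneousComponent_mem hH]
    intro j
    rcases lt_or_ge j m with hj | hj
    · exact low j hj
    · exact high (b.totalDegree + 1) j hj (by lia)
  rw [← hhb]
  exact add_mem hh (Ideal.mul_mem_left _ _ hbH)

/-- If all forms of large degree lie in `H + (l)`, then the Hilbert function of `R / H` is eventually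
the dimension of the finite dimensional algebra `R / (H + (l - 1))`. -/
theorem exists_finrank_graded_piece_eq [Finite σ] {H : Ideal (MvPolynomial σ K)}
    (hH : H.IsHomogeneous (homogeneousSubmodule σ K)) {l : MvPolynomial σ K}
    (hl : l.IsHomogeneous 1) {m₁ : ℕ}
    (hm : ∀ m ≥ m₁, ∀ F : MvPolynomial σ K, F.IsHomogeneous m → F ∈ H ⊔ Ideal.span {l}) :
    Module.Finite K (MvPolynomial σ K ⧸ H ⊔ Ideal.span {l - 1}) ∧
    ∃ m₀, ∀ m ≥ m₀,
      Module.finrank K ((homogeneousSubmodule σ K m).map (Ideal.Quotient.mkₐ K H).toLinearMap) =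
        Module.finrank K (MvPolynomial σ K ⧸ H ⊔ Ideal.span {l - 1}) := by
  obtain ⟨m₀, hm₀⟩ := exists_forall_mem_of_mem_sup_sub_one hH hl hm
  let T : (MvPolynomial σ K ⧸ H) →ₐ[K] (MvPolynomial σ K ⧸ H ⊔ Ideal.span {l - 1}) :=
    Ideal.Quotient.factorₐ K le_sup_left
  have hT : ∀ F, T (Ideal.Quotient.mkₐ K H F) = Ideal.Quotient.mk _ F := fun F => rfl
  have surj : ∀ m ≥ m₁, Function.Surjective (T.toLinearMap.domRestrict
      ((homogeneousSubmodule σ K m).map (Ideal.Quotient.mkₐ K H).toLinearMap)) := by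
    intro m hmm x
    obtain ⟨F, rfl⟩ := Ideal.Quotient.mk_surjective x
    obtain ⟨G, hG, hFG⟩ := exists_form_sub_mem hH hl hm hmm F
    exact ⟨⟨_, Submodule.mem_map_of_mem hG⟩, ((Ideal.Quotient.mk_eq_mk_iff_sub_mem F G).mpr hFG).symm⟩
  have hfin : ∀ m, Module.Finite K
      ((homogeneousSubmodule σ K m).map (Ideal.Quotient.mkₐ K H).toLinearMap) := fun m =>
    Module.Finite.iff_fg.mpr ((homogeneousSubmodule_fg σ K m).map _)
  refine ⟨?_, max m₀ m₁, fun m hmm => ?_⟩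
  · have := hfin m₁
    exact Module.Finite.of_surjective _ (surj m₁ le_rfl)
  · refine (LinearEquiv.ofBijective _ ⟨?_, surj m (le_of_max_le_right hmm)⟩).finrank_eq
    rw [← LinearMap.ker_eq_bot, LinearMap.ker_eq_bot']
    rintro ⟨_, F, hF, rfl⟩ hFT
    have h1 : F ∈ H ⊔ Ideal.span {l - 1} := Ideal.Quotient.eq_zero_iff_mem.mp hFT
    have h2 := hm₀ m (le_of_max_le_left hmm) F hF h1
    exact Subtype.ext (Ideal.Quotient.eq_zero_iff_mem.mpr h2)

end Graded

/-! ### Consequences of the Nullstellensatz -/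

section Nullstellensatz

variable {σ K : Type*} [Field K] [IsAlgClosed K] [Finite σ]

/-- If `J` vanishes on the zeros of `I`, then a power of `J` is contained in `I`. -/
theorem exists_pow_le_of_forall_zero {I J : Ideal (MvPolynomial σ K)}
    (h : ∀ v : σ → K, (∀ F ∈ I, eval v F = 0) → ∀ F ∈ J, eval v F = 0) : ∃ N, J ^ N ≤ I := by
  refine Ideal.exists_pow_le_of_le_radical_of_fg ?_ (IsNoetherian.noetherian J)
  rw [← vanishingIdeal_zeroLocus_eq_radical (K := K) I]
  intro F hF v hv
  exact h v (fun G hG => by simpa using hv G hG) F hF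

theorem eq_top_of_forall_not_zero {I : Ideal (MvPolynomial σ K)}
    (h : ∀ v : σ → K, ¬ ∀ F ∈ I, eval v F = 0) : I = ⊤ := by
  obtain ⟨N, hN⟩ := exists_pow_le_of_forall_zero (I := I) (J := ⊤) fun v hv => absurd hv (h v)
  rwa [Ideal.top_pow, top_le_iff] at hN

/-- If `0` is the only common zero of `I`, then `I` contains all the forms of large degree. -/
theorem exists_pow_idealOfVars_le {I : Ideal (MvPolynomial σ K)}
    (h : ∀ v : σ → K, (∀ F ∈ I, eval v F = 0) → v = 0) : ∃ N, idealOfVars σ K ^ N ≤ I := by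
  refine exists_pow_le_of_forall_zero fun v hv F hF => ?_
  rw [h v hv]
  refine Submodule.span_induction (p := fun F _ => eval (0 : σ → K) F = 0) ?_ ?_ ?_ ?_ hF
  · rintro _ ⟨i, rfl⟩; simp
  · simp
  · intro x y _ _ hx hy; rw [map_add, hx, hy, add_zero]
  · intro a x _ hx; rw [smul_eq_mul, map_mul, hx, mul_zero]

theorem exists_forall_form_mem_sup {H : Ideal (MvPolynomial σ K)} {l : MvPolynomial σ K}
    (h : ∀ v : σ → K, (∀ F ∈ H, eval v F = 0) → eval v l = 0 → v = 0) :
    ∃ m₁, ∀ m ≥ m₁, ∀ F : MvPolynomial σ K, F.IsHomogeneous m → F ∈ H ⊔ Ideal.span {l} := by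
  obtain ⟨N, hN⟩ := exists_pow_idealOfVars_le (I := H ⊔ Ideal.span {l}) fun v hv =>
    h v (fun F hF => hv F (Ideal.mem_sup_left hF))
      (hv l (Ideal.mem_sup_right (Ideal.mem_span_singleton_self l)))
  refine ⟨N, fun m hm F hF => hN ?_⟩
  rw [mem_pow_idealOfVars_iff]
  intro x hx
  have : x.degree = m := (hF.degree_eq_sum_deg_support hx).symm
  rwa [this]

end Nullstellensatz

/-! ### Linear forms and the homogeneous ideal of a projective point -/

section Linear

variable {σ K : Type*} [Field K]

/-- Finitely many nonzero vectors avoid a common hyperplane. -/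
theorem exists_linear_form_forall_ne_zero [Infinite K] [Fintype σ] {ι : Type*} [Finite ι]
    (a : ι → σ → K) (ha : ∀ i, a i ≠ 0) :
    ∃ l : MvPolynomial σ K, l.IsHomogeneous 1 ∧ ∀ i, eval (a i) l ≠ 0 := by
  classical
  cases nonempty_fintype ι
  -- The pairing of `a i` with a coefficient vector is viewed as a polynomial in that vector; a
  -- nonzero polynomial over an infinite field has a nonzero value.
  have h : ∏ i, ∑ j, C (a i j) * (X j : MvPolynomial σ K) ≠ 0 := by
    refine Finset.prod_ne_zero_iff.mpr fun i _ h0 => ?_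
    obtain ⟨j, hj⟩ := Function.ne_iff.mp (ha i)
    have := congrArg (eval (Pi.single j (1 : K))) h0
    simp [Pi.single_apply] at this
    exact hj this
  have : ∃ w : σ → K, eval w (∏ i, ∑ j, C (a i j) * (X j : MvPolynomial σ K)) ≠ 0 := by
    by_contra! h0
    exact h (MvPolynomial.funext fun w => by rw [h0 w, map_zero])
  obtain ⟨w, hw⟩ := this
  refine ⟨∑ j, C (w j) * X j, IsHomogeneous.sum _ _ _ fun j _ => isHomogeneous_C_mul_X _ _,
    fun i => ?_⟩
  rw [map_prod] at hw
  have := Finset.prod_ne_zero_iff.mp hw i (Finset.mem_univ i)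
  simpa [mul_comm] using this

/-- The homogeneous ideal of the line spanned by `a`, generated by linear forms. -/
def pointIdeal (a : σ → K) : Ideal (MvPolynomial σ K) :=
  Ideal.span {F | F.IsHomogeneous 1 ∧ eval a F = 0}

theorem isHomogeneous_minor (a : σ → K) (i j : σ) :
    (C (a i) * X j - C (a j) * X i : MvPolynomial σ K).IsHomogeneous 1 :=
  (isHomogeneous_C_mul_X _ _).sub (isHomogeneous_C_mul_X _ _)

theorem minor_mem_pointIdeal (a : σ → K) (i j : σ) :
    (C (a i) * X j - C (a j) * X i : MvPolynomial σ K) ∈ pointIdeal a :=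
  Ideal.subset_span ⟨isHomogeneous_minor a i j, by simp [mul_comm]⟩

theorem exists_eq_smul_of_pointIdeal {a v : σ → K} (ha : a ≠ 0)
    (h : ∀ F ∈ pointIdeal a, eval v F = 0) : ∃ c : K, v = c • a := by
  obtain ⟨i, hi⟩ := Function.ne_iff.mp ha
  refine ⟨v i / a i, funext fun j => ?_⟩
  have := h _ (minor_mem_pointIdeal a i j)
  simp only [map_sub, map_mul, eval_C, eval_X] at this
  rw [Pi.zero_apply] at hi
  rw [Pi.smul_apply, smul_eq_mul]
  field_simp
  linear_combination this

theorem eval_smul_of_isHomogeneous {F : MvPolynomial σ K} {m : ℕ} (hF : F.IsHomogeneous m) (c : K)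
    (v : σ → K) : eval (c • v) F = c ^ m * eval v F := by
  rw [eval_eq, eval_eq, Finset.mul_sum]
  refine Finset.sum_congr rfl fun x hx => ?_
  simp only [Pi.smul_apply, smul_eq_mul, mul_pow, Finset.prod_mul_distrib]
  rw [Finset.prod_pow_eq_pow_sum]
  have : ∑ i ∈ x.support, x i = m := by
    rw [hF.degree_eq_sum_deg_support hx]
  rw [this]; ring

theorem eval_smul_eq_zero_of_pointIdeal (a : σ → K) (c : K) {F : MvPolynomial σ K}
    (hF : F ∈ pointIdeal a) : eval (c • a) F = 0 := by
  refine Submodule.span_induction (p := fun F _ => eval (c • a) F = 0) ?_ ?_ ?_ ?_ hF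
  · rintro G ⟨h1, h2⟩; rw [eval_smul_of_isHomogeneous h1, h2, mul_zero]
  · simp
  · intro x y _ _ hx hy; rw [map_add, hx, hy, add_zero]
  · intro a x _ hx; rw [smul_eq_mul, map_mul, hx, mul_zero]

theorem exists_eq_smul_of_pointIdeal_pow {a v : σ → K} (ha : a ≠ 0) {N : ℕ}
    (h : ∀ F ∈ pointIdeal a ^ N, eval v F = 0) : ∃ c : K, v = c • a := by
  refine exists_eq_smul_of_pointIdeal ha fun F hF => ?_
  have := h _ (Ideal.pow_mem_pow hF N)
  rw [map_pow] at this
  exact eq_zero_of_pow_eq_zero this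

attribute [local instance] MvPolynomial.gradedAlgebra in
theorem isHomogeneous_pointIdeal (a : σ → K) :
    (pointIdeal a).IsHomogeneous (homogeneousSubmodule σ K) :=
  isHomogeneous_span_forms fun _ hF => ⟨1, hF.1⟩

end Linear

/-! ### Chinese remainder theorem relative to an ideal -/

section ChineseRemainder

theorem prod_sup_le {R ι : Type*} [CommRing R] (Q : Ideal R) (A : ι → Ideal R) (s : Finset ι) :
    ∏ i ∈ s, (Q ⊔ A i) ≤ Q ⊔ ∏ i ∈ s, A i := by
  classical
  induction s using Finset.induction_on with
  | empty => simp
  | insert i s hi ih =>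
    rw [Finset.prod_insert hi, Finset.prod_insert hi]
    refine (Ideal.mul_mono_right ih).trans ?_
    rw [Ideal.sup_mul, Ideal.mul_sup (A i)]
    refine sup_le (le_sup_of_le_left Ideal.mul_le_left) (sup_le (le_sup_of_le_left ?_) le_sup_right)
    exact Ideal.mul_le_right

/-- The kernel of the map to the product vanishes because, by coprimality, `⨅ (Q ⊔ A i)` is the
product of these ideals, which lies in `Q ⊔ ∏ A i = Q`. -/
theorem finrank_quotient_eq_sum {K R ι : Type*} [Field K] [CommRing R] [Algebra K R] [Fintype ι]
    (Q : Ideal R) (A : ι → Ideal R)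
    (hco : Pairwise fun i j => IsCoprime (Q ⊔ A i) (Q ⊔ A j)) (hprod : ∏ i, A i ≤ Q)
    (hfin : ∀ i, Module.Finite K (R ⧸ Q ⊔ A i)) :
    Module.finrank K (R ⧸ Q) = ∑ i, Module.finrank K (R ⧸ Q ⊔ A i) := by
  rw [← Module.finrank_pi_fintype]
  let T : (R ⧸ Q) →ₗ[K] ∀ i, R ⧸ Q ⊔ A i :=
    LinearMap.pi fun i => (Ideal.Quotient.factorₐ K (le_sup_left : Q ≤ Q ⊔ A i)).toLinearMap
  have hT : ∀ x i, T (Ideal.Quotient.mk Q x) i = Ideal.Quotient.mk (Q ⊔ A i) x := fun _ _ => rfl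
  refine (LinearEquiv.ofBijective T ⟨?_, fun y => ?_⟩).finrank_eq
  · rw [← LinearMap.ker_eq_bot, LinearMap.ker_eq_bot']
    intro x hx
    obtain ⟨x, rfl⟩ := Ideal.Quotient.mk_surjective x
    have h1 : ∀ i, x ∈ Q ⊔ A i := fun i => by
      rw [← Ideal.Quotient.eq_zero_iff_mem, ← hT, hx]; rfl
    have h2 : x ∈ ∏ i, (Q ⊔ A i) := by
      rw [Ideal.prod_eq_iInf_of_pairwise_isCoprime fun i _ j _ hij => hco hij]
      simpa using h1
    exact Ideal.Quotient.eq_zero_iff_mem.mpr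
      ((prod_sup_le Q A _).trans (sup_le le_rfl hprod) h2)
  · obtain ⟨r, hr⟩ := Ideal.pi_quotient_surjective hco y
    exact ⟨Ideal.Quotient.mk Q r, funext fun i => hr i⟩

end ChineseRemainder

/-! ### Hilbert polynomial of a finite projective scheme as a sum over its points -/

section Global

variable {σ K : Type*} [Field K] [IsAlgClosed K] [Fintype σ]

attribute [local instance] MvPolynomial.gradedAlgebra

/-- The graded pieces do not involve `l`. The local dimension is therefore the same for every linear
form not vanishing at `a`, which allows a change of chart. -/
theorem finrank_sup_pointIdeal_pow {J : Ideal (MvPolynomial σ K)}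
    (hJ : J.IsHomogeneous (homogeneousSubmodule σ K)) {a : σ → K} (ha : a ≠ 0) (N : ℕ)
    {l : MvPolynomial σ K} (hl : l.IsHomogeneous 1) (hal : eval a l ≠ 0) :
    Module.Finite K (MvPolynomial σ K ⧸ J ⊔ pointIdeal a ^ N ⊔ Ideal.span {l - 1}) ∧
    ∃ m₀, ∀ m ≥ m₀,
      Module.finrank K ((homogeneousSubmodule σ K m).map
        (Ideal.Quotient.mkₐ K (J ⊔ pointIdeal a ^ N)).toLinearMap) =
      Module.finrank K (MvPolynomial σ K ⧸ J ⊔ pointIdeal a ^ N ⊔ Ideal.span {l - 1}) := by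
  obtain ⟨m₁, hm₁⟩ := exists_forall_form_mem_sup (H := J ⊔ pointIdeal a ^ N) (l := l)
    fun v hv hvl => by
      obtain ⟨c, rfl⟩ := exists_eq_smul_of_pointIdeal_pow ha
        fun F hF => hv F (Ideal.mem_sup_right hF)
      rw [eval_smul_of_isHomogeneous hl, pow_one] at hvl
      rw [(mul_eq_zero.mp hvl).resolve_right hal, zero_smul]
  exact exists_finrank_graded_piece_eq
    (hJ.sup (isHomogeneous_ideal_pow (isHomogeneous_pointIdeal a) N)) hl hm₁

/-- The Hilbert function of a projective scheme supported at finitely many points is eventually the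
sum of the dimensions of the local contributions, which may be computed in any affine charts. -/
theorem exists_finrank_piece_eq_sum {J : Ideal (MvPolynomial σ K)}
    (hJ : J.IsHomogeneous (homogeneousSubmodule σ K)) {ι : Type*} [Fintype ι] (a : ι → σ → K)
    (ha : ∀ i, a i ≠ 0) (hne : ∀ i j, i ≠ j → ∀ c : K, c ≠ 0 → c • a i ≠ a j)
    (hzero : ∀ v : σ → K, v ≠ 0 → (∀ F ∈ J, eval v F = 0) → ∃ i, ∃ c : K, v = c • a i)
    (l : ι → MvPolynomial σ K) (hl : ∀ i, (l i).IsHomogeneous 1)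
    (hal : ∀ i, eval (a i) (l i) ≠ 0) :
    ∃ N₀, ∀ N ≥ N₀, ∃ m₀, ∀ m ≥ m₀,
      Module.finrank K ((homogeneousSubmodule σ K m).map (Ideal.Quotient.mkₐ K J).toLinearMap) =
      ∑ i, Module.finrank K
        (MvPolynomial σ K ⧸ J ⊔ pointIdeal (a i) ^ N ⊔ Ideal.span {l i - 1}) := by
  have : Infinite K := IsAlgClosed.instInfinite
  obtain ⟨g, hg, hag⟩ := exists_linear_form_forall_ne_zero a ha
  obtain ⟨m₁, hm₁⟩ := exists_forall_form_mem_sup (H := J) (l := g) fun v hv hvl => by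
    by_contra hv0
    obtain ⟨i, c, rfl⟩ := hzero v hv0 hv
    rw [eval_smul_of_isHomogeneous hg, pow_one] at hvl
    exact hv0 (by rw [(mul_eq_zero.mp hvl).resolve_right (hag i), zero_smul])
  obtain ⟨-, m₂, hm₂⟩ := exists_finrank_graded_piece_eq hJ hg hm₁
  have hg1 : ∀ {I : Ideal (MvPolynomial σ K)} {v : σ → K},
      (∀ F ∈ I ⊔ Ideal.span {g - 1}, eval v F = 0) → eval v g = 1 := by
    intro I v hv
    have := hv (g - 1) (Ideal.mem_sup_right (Ideal.mem_span_singleton_self _))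
    rw [map_sub, map_one] at this
    exact sub_eq_zero.mp this
  have hg0 : eval (0 : σ → K) g = 0 := by
    have := eval_smul_of_isHomogeneous hg 0 0
    rwa [zero_smul, pow_one, zero_mul] at this
  -- The zeros of `J + (g - 1)` are nonzero zeros of `J`, hence lie on the lines through the `a i`,
  -- where the product of the point ideals vanishes.
  obtain ⟨N₀, hN₀⟩ := exists_pow_le_of_forall_zero (I := J ⊔ Ideal.span {g - 1})
    (J := ∏ i, pointIdeal (a i)) fun v hv F hF => by
      have hv0 : v ≠ 0 := by
        rintro rfl
        have := hg1 hv
        rw [hg0] at this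
        exact zero_ne_one this
      obtain ⟨i, c, rfl⟩ := hzero v hv0 fun F hF => hv F (Ideal.mem_sup_left hF)
      exact eval_smul_eq_zero_of_pointIdeal _ _
        ((Ideal.prod_le_inf.trans (Finset.inf_le (Finset.mem_univ i))) hF)
  refine ⟨N₀, fun N hN => ?_⟩
  have hloc := fun i => finrank_sup_pointIdeal_pow hJ (ha i) N hg (hag i)
  have hloc' := fun i => finrank_sup_pointIdeal_pow hJ (ha i) N (hl i) (hal i)
  refine ⟨m₂, fun m hm => ?_⟩
  rw [hm₂ m hm, finrank_quotient_eq_sum (K := K) (J ⊔ Ideal.span {g - 1})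
    (fun i => pointIdeal (a i) ^ N)]
  · refine Finset.sum_congr rfl fun i _ => ?_
    obtain ⟨-, m₃, h₃⟩ := hloc i
    obtain ⟨-, m₄, h₄⟩ := hloc' i
    -- Both dimensions equal the same graded piece in a common large degree, so `g` may be exchanged
    -- for `l i`.
    rw [sup_right_comm, ← h₃ (max m₃ m₄) (le_max_left _ _), h₄ _ (le_max_right _ _)]
  · intro i j hij
    rw [Ideal.isCoprime_iff_sup_eq]
    refine eq_top_of_forall_not_zero fun v hv => ?_
    obtain ⟨c, hc⟩ := exists_eq_smul_of_pointIdeal_pow (v := v) (N := N) (ha i)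
      fun F hF => hv F (Ideal.mem_sup_left (Ideal.mem_sup_right hF))
    obtain ⟨c', hc'⟩ := exists_eq_smul_of_pointIdeal_pow (v := v) (N := N) (ha j)
      fun F hF => hv F (Ideal.mem_sup_right (Ideal.mem_sup_right hF))
    have hv1 : eval v g = 1 := hg1 (I := J) fun F hF => hv F (Ideal.mem_sup_left
      (Ideal.mem_sup_left hF))
    have hv0 : v ≠ 0 := by
      rintro rfl
      rw [hg0] at hv1
      exact zero_ne_one hv1
    have hc0 : c ≠ 0 := by rintro rfl; exact hv0 (by rw [hc, zero_smul])
    have hc0' : c' ≠ 0 := by rintro rfl; exact hv0 (by rw [hc', zero_smul])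
    refine hne i j hij (c'⁻¹ * c) (mul_ne_zero (inv_ne_zero hc0') hc0) ?_
    rw [mul_smul, ← hc, hc', smul_smul, inv_mul_cancel₀ hc0', one_smul]
  · rw [Finset.prod_pow]
    exact (Ideal.pow_le_pow_right hN).trans hN₀
  · intro i
    have := (hloc i).1
    rwa [sup_right_comm] at this

end Global

/-! ### Passage to an affine chart centred at a point -/

section Dehomogenize

variable {n : ℕ} (c : Fin (n + 1)) (b : Fin n → ℂ)

/-- Substitution of the affine coordinates `b + y` of the chart `x_c = 1`. -/
def dehomogenize : MvPolynomial (Fin (n + 1)) ℂ →ₐ[ℂ] MvPolynomial (Fin n) ℂ :=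
  aeval (c.insertNth (α := fun _ => MvPolynomial (Fin n) ℂ) 1 fun j : Fin n => C (b j) + X j)

@[simp]
theorem dehomogenize_X_self : dehomogenize c b (X c) = 1 := by
  simp [dehomogenize]

@[simp]
theorem dehomogenize_X_succAbove (j : Fin n) :
    dehomogenize c b (X (c.succAbove j)) = C (b j) + X j := by
  simp [dehomogenize]

@[simp]
theorem dehomogenize_C (r : ℂ) : dehomogenize c b (C r) = C r := by
  simp [dehomogenize, algebraMap_eq]

theorem pderiv_dehomogenize (j : Fin n) (F : MvPolynomial (Fin (n + 1)) ℂ) :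
    pderiv j (dehomogenize c b F) = dehomogenize c b (pderiv (c.succAbove j) F) := by
  classical
  induction F using MvPolynomial.induction_on with
  | C r => simp
  | add p q hp hq => simp only [map_add, hp, hq]
  | mul_X p i hp =>
    rw [map_mul, pderiv_mul, pderiv_mul, map_add, map_mul, map_mul, hp]
    congr 2
    rcases Fin.eq_self_or_eq_succAbove c i with rfl | ⟨i, rfl⟩
    · rw [dehomogenize_X_self, pderiv_X_of_ne (Fin.succAbove_ne i j).symm]
      simp
    · rw [dehomogenize_X_succAbove, pderiv_X]
      by_cases hij : i = j
      · subst hij; simp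
      · rw [Pi.single_eq_of_ne (fun h => hij (Fin.succAbove_right_injective h))]
        simp [pderiv_X_of_ne hij]

theorem foldr_pderiv_dehomogenize (l : List (Fin n)) (F : MvPolynomial (Fin (n + 1)) ℂ) :
    l.foldr (fun i g => pderiv i g) (dehomogenize c b F) =
      dehomogenize c b ((l.map c.succAbove).foldr (fun i g => pderiv i g) F) := by
  induction l with
  | nil => rfl
  | cons i l ih => simp only [List.foldr_cons, List.map_cons, ih, pderiv_dehomogenize]

theorem dehomogenize_surjective : Function.Surjective (dehomogenize c b) := by
  rw [← AlgHom.range_eq_top, ← top_le_iff, ← adjoin_range_X, Algebra.adjoin_le_iff]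
  rintro _ ⟨j, rfl⟩
  exact ⟨X (c.succAbove j) - C (b j), by simp⟩

/-- Substituting `X (c.succAbove j) - C (b j)` back for the affine coordinates undoes `dehomogenize`
modulo `X c - 1`. -/
theorem ker_dehomogenize : RingHom.ker (dehomogenize c b) = Ideal.span {X c - 1} := by
  apply le_antisymm
  · let s : MvPolynomial (Fin n) ℂ →ₐ[ℂ] MvPolynomial (Fin (n + 1)) ℂ :=
      aeval fun j => X (c.succAbove j) - C (b j)
    have h : ((Ideal.Quotient.mkₐ ℂ (Ideal.span {X c - 1})).comp s).comp (dehomogenize c b) =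
        Ideal.Quotient.mkₐ ℂ (Ideal.span {X c - 1}) := by
      refine MvPolynomial.algHom_ext fun i => ?_
      rcases Fin.eq_self_or_eq_succAbove c i with rfl | ⟨i, rfl⟩
      · have : Ideal.Quotient.mk (Ideal.span {X i - 1}) (X i : MvPolynomial (Fin (n + 1)) ℂ) =
            Ideal.Quotient.mk _ 1 :=
          (Ideal.Quotient.mk_eq_mk_iff_sub_mem _ _).mpr (Ideal.mem_span_singleton_self _)
        simp [this]
      · simp [s, ← algebraMap_eq]
    intro F hF
    rw [← Ideal.Quotient.eq_zero_iff_mem]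
    have h1 := congrArg (fun u => u F) h
    have h2 : dehomogenize c b F = 0 := hF
    simp only [AlgHom.comp_apply, h2, map_zero] at h1
    exact h1.symm
  · rw [Ideal.span_singleton_le_iff_mem]
    simp [RingHom.mem_ker]

theorem nonempty_quotient_sup_X_sub_one_equiv (I : Ideal (MvPolynomial (Fin (n + 1)) ℂ)) :
    Nonempty ((MvPolynomial (Fin (n + 1)) ℂ ⧸ I ⊔ Ideal.span {X c - 1}) ≃ₗ[ℂ]
      (MvPolynomial (Fin n) ℂ ⧸ I.map (dehomogenize c b))) := by
  let T : MvPolynomial (Fin (n + 1)) ℂ →ₐ[ℂ] MvPolynomial (Fin n) ℂ ⧸ I.map (dehomogenize c b) :=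
    (Ideal.Quotient.mkₐ ℂ (I.map (dehomogenize c b))).comp (dehomogenize c b)
  have hT : Function.Surjective T :=
    (Ideal.Quotient.mkₐ_surjective ℂ _).comp (dehomogenize_surjective c b)
  have hker : RingHom.ker T = I ⊔ Ideal.span {X c - 1} := by
    rw [← ker_dehomogenize c b,
      ← Ideal.comap_map_of_surjective' (dehomogenize c b) (dehomogenize_surjective c b)]
    ext F
    exact Ideal.Quotient.eq_zero_iff_mem
  rw [← hker]
  exact ⟨(Ideal.quotientKerAlgEquivOfSurjective hT).toLinearEquiv⟩

theorem mem_idealOfVars_iff_eval {σ R : Type*} [CommRing R] (F : MvPolynomial σ R) :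
    F ∈ idealOfVars σ R ↔ eval 0 F = 0 := by
  rw [← pow_one (idealOfVars σ R), mem_pow_idealOfVars_iff']
  simp [constantCoeff_eq, Finsupp.degree_eq_zero_iff]

/-- The point of the chart `x_c = 1` with affine coordinates `b + y`. -/
theorem eval_dehomogenize (y : Fin n → ℂ) (F : MvPolynomial (Fin (n + 1)) ℂ) :
    eval y (dehomogenize c b F) = eval (c.insertNth (α := fun _ => ℂ) 1 fun j => b j + y j) F := by
  induction F using MvPolynomial.induction_on with
  | C r => simp
  | add p q hp hq => simp only [map_add, hp, hq]
  | mul_X p i hp =>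
    rw [map_mul, map_mul, map_mul, hp]
    congr 1
    rcases Fin.eq_self_or_eq_succAbove c i with rfl | ⟨i, rfl⟩ <;> simp

theorem eval_zero_dehomogenize {a : Fin (n + 1) → ℂ} (hac : a c ≠ 0)
    (F : MvPolynomial (Fin (n + 1)) ℂ) :
    eval 0 (dehomogenize c (fun j => a (c.succAbove j) / a c) F) = eval ((a c)⁻¹ • a) F := by
  rw [eval_dehomogenize]
  congr 2
  funext i
  rcases Fin.eq_self_or_eq_succAbove c i with rfl | ⟨i, rfl⟩
  · simp [hac]
  · simp [div_eq_inv_mul]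

/-- The chart origin is `a` rescaled, so forms vanishing at `a` land in the maximal ideal;
conversely the minor `a_c x_j - a_j x_c` becomes `a_c y_j`. -/
theorem map_dehomogenize_pointIdeal {a : Fin (n + 1) → ℂ} (hac : a c ≠ 0) :
    (pointIdeal a).map (dehomogenize c fun j => a (c.succAbove j) / a c) =
      idealOfVars (Fin n) ℂ := by
  apply le_antisymm
  · rw [pointIdeal, Ideal.map_span, Ideal.span_le]
    rintro _ ⟨F, ⟨hF, hF0⟩, rfl⟩
    rw [SetLike.mem_coe, mem_idealOfVars_iff_eval, eval_zero_dehomogenize c hac,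
      eval_smul_of_isHomogeneous hF, hF0, mul_zero]
  · rw [idealOfVars, Ideal.span_le]
    rintro _ ⟨j, rfl⟩
    have h := Ideal.mem_map_of_mem (dehomogenize c fun j => a (c.succAbove j) / a c)
      (minor_mem_pointIdeal a c (c.succAbove j))
    have h2 := Ideal.mul_mem_left _ (C (a c)⁻¹) h
    have h3 : C (a c)⁻¹ * dehomogenize c (fun j => a (c.succAbove j) / a c)
        (C (a c) * X (c.succAbove j) - C (a (c.succAbove j)) * X c) = X j := ?_
    · rwa [h3] at h2
    simp only [map_sub, map_mul, dehomogenize_C, dehomogenize_X_self, dehomogenize_X_succAbove]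
    rw [mul_add, ← C_mul, mul_div_cancel₀ _ hac, mul_one, add_sub_cancel_left, ← mul_assoc, ← C_mul,
      inv_mul_cancel₀ hac, C_1, one_mul]

end Dehomogenize

/-! ### Euler's identity and the dehomogenized Jacobian ideal -/

section Euler

theorem pderiv_pderiv_comm {σ R : Type*} [CommRing R] (i j : σ) (F : MvPolynomial σ R) :
    pderiv i (pderiv j F) = pderiv j (pderiv i F) := by
  classical
  have h : ⁅pderiv (R := R) i, pderiv (R := R) j⁆ = 0 := by
    refine derivation_ext fun k => ?_
    simp only [Derivation.commutator_apply, pderiv_X, Derivation.zero_apply]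
    simp [Pi.single_apply, apply_ite]
  have := congrArg (fun D => D F) h
  simpa [Derivation.commutator_apply, sub_eq_zero] using this

variable {n : ℕ}

theorem foldr_pderiv_perm {σ : Type*} {l l' : List σ} (h : l.Perm l') (F : MvPolynomial σ ℂ) :
    l.foldr (fun i g => pderiv i g) F = l'.foldr (fun i g => pderiv i g) F := by
  have : LeftCommutative (fun (i : σ) (g : MvPolynomial σ ℂ) => pderiv i g) :=
    ⟨fun i j F => pderiv_pderiv_comm i j F⟩
  exact h.foldr_eq F

theorem isHomogeneous_foldr_pderiv {σ : Type*} {d : ℕ} {f : MvPolynomial σ ℂ}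
    (hf : f.IsHomogeneous d) (l : List σ) :
    (l.foldr (fun i g => pderiv i g) f).IsHomogeneous (d - l.length) := by
  induction l with
  | nil => exact hf
  | cons i l ih =>
    have := ih.pderiv (i := i)
    rwa [Nat.sub_sub] at this

variable {d k : ℕ} {f : MvPolynomial (Fin (n + 1)) ℂ}

attribute [local instance] MvPolynomial.gradedAlgebra in
theorem isHomogeneous_jacobianIdeal (hf : f.IsHomogeneous d) (k : ℕ) :
    (jacobianIdeal k f).IsHomogeneous (homogeneousSubmodule (Fin (n + 1)) ℂ) := by
  refine isHomogeneous_span_forms ?_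
  rintro _ ⟨l, -, rfl⟩
  exact ⟨_, isHomogeneous_foldr_pderiv hf l⟩

/-- By Euler's identity, derivatives of lower order lie in the Jacobian ideal too. -/
theorem foldr_pderiv_mem_jacobianIdeal (hf : f.IsHomogeneous d) (hkd : k ≤ d)
    (l : List (Fin (n + 1))) (hl : l.length ≤ k) :
    l.foldr (fun i g => pderiv i g) f ∈ jacobianIdeal k f := by
  obtain ⟨t, ht⟩ := Nat.exists_eq_add_of_le hl
  induction t generalizing l with
  | zero => exact Ideal.subset_span ⟨l, by lia, rfl⟩
  | succ t ih =>
    have hE := (isHomogeneous_foldr_pderiv hf l).sum_X_mul_pderiv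
    have h1 : (d - l.length) • l.foldr (fun i g => pderiv i g) f ∈ jacobianIdeal k f := by
      rw [← hE]
      refine Ideal.sum_mem _ fun i _ => Ideal.mul_mem_left _ _ ?_
      exact ih (i :: l) (by simp; lia) (by simp; lia)
    -- Here `l.length < k ≤ d`, so the Euler factor is a positive integer, invertible in `ℂ`.
    have hne : ((d - l.length : ℕ) : ℂ) ≠ 0 := by
      rw [Nat.cast_ne_zero]; lia
    have h2 := Ideal.mul_mem_left _ (C ((d - l.length : ℕ) : ℂ)⁻¹) h1
    rw [nsmul_eq_mul, ← map_natCast (C (σ := Fin (n + 1)) (R := ℂ)), ← mul_assoc, ← C_mul,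
      inv_mul_cancel₀ hne, C_1, one_mul] at h2
    exact h2

/-- The polynomial analogue of the Tjurina ideal. -/
def polynomialTjurinaIdeal {n : ℕ} (k : ℕ) (g : MvPolynomial (Fin n) ℂ) :
    Ideal (MvPolynomial (Fin n) ℂ) :=
  Ideal.span {h | ∃ l : List (Fin n), l.length ≤ k ∧ h = l.foldr (fun i g => pderiv i g) g}

/-- Induction on the number of derivatives in direction `c`. At `x_c = 1`, Euler's identity writes
`∂_c G` through `G` and the other `∂_j G`, without raising the order. -/
theorem dehomogenize_foldr_pderiv_mem (hf : f.IsHomogeneous d) (c : Fin (n + 1)) (b : Fin n → ℂ)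
    (L : List (Fin (n + 1))) (hL : L.length ≤ k) :
    dehomogenize c b (L.foldr (fun i g => pderiv i g) f) ∈
      polynomialTjurinaIdeal k (dehomogenize c b f) := by
  classical
  induction hr : L.count c generalizing L with
  | zero =>
    have hc : c ∉ L := List.count_eq_zero.mp hr
    have : ∃ l : List (Fin n), l.map c.succAbove = L := by
      rw [← Set.mem_range, Set.range_list_map, Set.mem_ofPred]
      intro x hx
      rw [Fin.range_succAbove]
      rintro rfl
      exact hc hx
    obtain ⟨l, rfl⟩ := this
    rw [← foldr_pderiv_dehomogenize]
    exact Ideal.subset_span ⟨l, by simpa using hL, rfl⟩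
  | succ r ih =>
    have hc : c ∈ L := List.count_pos_iff.mp (by lia)
    have hperm := List.perm_cons_erase hc
    rw [foldr_pderiv_perm hperm, List.foldr_cons]
    have hlen : (L.erase c).length + 1 = L.length := by
      rw [hperm.length_eq, List.length_cons]
    have hcount : (L.erase c).count c = r := by
      rw [List.count_erase_self, hr]; rfl
    set G := (L.erase c).foldr (fun i g => pderiv i g) f with hG
    have hE := (isHomogeneous_foldr_pderiv hf (L.erase c)).sum_X_mul_pderiv
    rw [← hG, Fin.sum_univ_succAbove _ c] at hE
    have hE' := congrArg (dehomogenize c b) hE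
    rw [map_add, map_mul, dehomogenize_X_self, one_mul, map_sum, map_nsmul] at hE'
    rw [eq_sub_of_add_eq hE']
    refine sub_mem (nsmul_mem (ih _ (by lia) hcount) _) (Ideal.sum_mem _ fun j _ => ?_)
    rw [map_mul]
    refine Ideal.mul_mem_left _ _ (ih (c.succAbove j :: L.erase c) (by simp; lia) ?_)
    rw [List.count_cons_of_ne (Fin.succAbove_ne c j), hcount]

theorem map_dehomogenize_jacobianIdeal (hf : f.IsHomogeneous d) (hkd : k ≤ d) (c : Fin (n + 1))
    (b : Fin n → ℂ) :
    (jacobianIdeal k f).map (dehomogenize c b) =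
      polynomialTjurinaIdeal k (dehomogenize c b f) := by
  apply le_antisymm
  · rw [jacobianIdeal, Ideal.map_span, Ideal.span_le]
    rintro _ ⟨_, ⟨L, hL, rfl⟩, rfl⟩
    exact dehomogenize_foldr_pderiv_mem hf c b L hL.le
  · rw [polynomialTjurinaIdeal, Ideal.span_le]
    rintro _ ⟨l, hl, rfl⟩
    rw [foldr_pderiv_dehomogenize]
    exact Ideal.mem_map_of_mem _ (foldr_pderiv_mem_jacobianIdeal hf hkd _ (by simpa using hl))

end Euler

/-! ### Convergent power series and comparison with polynomials -/

section Convergent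

variable {n : ℕ}

/-- The sum runs over the exponents below `β` and factors into `n` geometric sums, each at most `2`.
-/
theorem sum_antidiagonal_half_pow_le (β : Fin n →₀ ℕ) :
    ∑ x ∈ Finset.HasAntidiagonal.antidiagonal β, (1 / 2 : ℝ) ^ x.1.degree ≤ 2 ^ n := by
  classical
  let e : (Fin n →₀ ℕ) × (Fin n →₀ ℕ) → (Fin n → ℕ) := fun x => x.1
  have hinj : Set.InjOn e (Finset.HasAntidiagonal.antidiagonal β) := by
    intro x hx y hy hxy
    have hxy' : x.1 = y.1 := DFunLike.coe_injective hxy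
    have hx' := Finset.HasAntidiagonal.mem_antidiagonal.mp hx
    have hy' := Finset.HasAntidiagonal.mem_antidiagonal.mp hy
    refine Prod.ext hxy' (add_left_cancel (a := x.1) ?_)
    rw [hx', hxy', hy']
  have hterm : ∀ x ∈ Finset.HasAntidiagonal.antidiagonal β,
      (1 / 2 : ℝ) ^ x.1.degree = ∏ i, (1 / 2 : ℝ) ^ (e x i) := by
    intro x _
    rw [Finset.prod_pow_eq_pow_sum, Finsupp.degree_eq_sum]
  rw [Finset.sum_congr rfl hterm, ← Finset.sum_image (f := fun y => ∏ i, (1 / 2 : ℝ) ^ y i) hinj]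
  calc _ ≤ ∑ y ∈ Fintype.piFinset fun i => Finset.range (β i + 1), ∏ i, (1 / 2 : ℝ) ^ y i := by
        refine Finset.sum_le_sum_of_subset_of_nonneg ?_ fun _ _ _ => by positivity
        intro y hy
        obtain ⟨x, hx, rfl⟩ := Finset.mem_image.mp hy
        have hx' := Finset.HasAntidiagonal.mem_antidiagonal.mp hx
        refine Fintype.mem_piFinset.mpr fun i => Finset.mem_range.mpr ?_
        rw [← hx']
        simp [e]
    _ = ∏ i, ∑ a ∈ Finset.range (β i + 1), (1 / 2 : ℝ) ^ a := (Finset.prod_univ_sum _ _).symm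
    _ ≤ ∏ _i : Fin n, (2 : ℝ) := by
        refine Finset.prod_le_prod (fun i _ => by positivity) fun i _ => sum_geometric_two_le _
    _ = 2 ^ n := by simp

theorem IsConvergent.inv {g : MvPowerSeries (Fin n) ℂ} (hg : IsConvergent g) :
    IsConvergent g⁻¹ := by
  classical
  obtain ⟨C, K, hC, hK, H⟩ := hg
  -- If the constant coefficient is zero, then `u = 0` and `g⁻¹ = 0`, and the bound below still
  -- holds.
  set u := ‖(MvPowerSeries.constantCoeff g)⁻¹‖ with hu
  have hu0 : 0 ≤ u := norm_nonneg _
  set M : ℝ := 1 + u * C * 2 ^ n with hM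
  have hM1 : 1 ≤ M := by
    have : 0 ≤ u * C * 2 ^ n := by positivity
    linarith
  have hM0 : 0 < M := by linarith
  -- In the recursion for `g⁻¹` every surviving term has `x.1 ≠ 0`. The factor `M` in `L` then gains
  -- `M⁻¹`, the factor `2` makes the sum at most `2 ^ n`, and `u * C * 2 ^ n ≤ M` closes the
  -- induction.
  set L : ℝ := 2 * M * K with hL
  have hL0 : 0 < L := by positivity
  have bound : ∀ β : Fin n →₀ ℕ, ‖MvPowerSeries.coeff β g⁻¹‖ ≤ u * L ^ β.degree := by
    intro β
    induction β using WellFoundedLT.induction with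
    | ind β ih =>
    rw [MvPowerSeries.coeff_inv]
    split_ifs with hβ
    · simp [hβ, hu]
    rw [norm_mul, norm_neg, ← hu]
    refine mul_le_mul_of_nonneg_left ?_ hu0
    have hterm : ∀ x ∈ Finset.HasAntidiagonal.antidiagonal β,
        ‖if x.2 < β then MvPowerSeries.coeff x.1 g * MvPowerSeries.coeff x.2 g⁻¹ else 0‖ ≤
          u * C * M⁻¹ * L ^ β.degree * (1 / 2 : ℝ) ^ x.1.degree := by
      intro x hx
      have hx' := Finset.HasAntidiagonal.mem_antidiagonal.mp hx
      split_ifs with hlt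
      · have hne : x.1.degree ≠ 0 := by
          intro h0
          rw [Finsupp.degree_eq_zero_iff] at h0
          rw [h0, zero_add] at hx'
          exact hlt.ne hx'
        have hpow : M * K ^ x.1.degree ≤ L ^ x.1.degree * (1 / 2 : ℝ) ^ x.1.degree := by
          rw [← mul_pow, show L * (1 / 2) = M * K by rw [hL]; ring, mul_pow]
          gcongr
          exact le_self_pow₀ hM1 hne
        rw [norm_mul]
        calc _ ≤ (C * K ^ x.1.degree) * (u * L ^ x.2.degree) := by
              gcongr
              · exact H _
              · exact ih _ hlt
          _ = u * C * M⁻¹ * (M * K ^ x.1.degree) * L ^ x.2.degree := by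
              field_simp
          _ ≤ u * C * M⁻¹ * (L ^ x.1.degree * (1 / 2 : ℝ) ^ x.1.degree) * L ^ x.2.degree := by
              gcongr
          _ = _ := by
              rw [← hx', map_add, pow_add]; ring
      · rw [norm_zero]; positivity
    refine (norm_sum_le_of_le _ hterm).trans ?_
    rw [← Finset.mul_sum]
    calc _ ≤ u * C * M⁻¹ * L ^ β.degree * 2 ^ n := by
          gcongr
          exact sum_antidiagonal_half_pow_le β
      _ = (u * C * 2 ^ n * M⁻¹) * L ^ β.degree := by ring
      _ ≤ 1 * L ^ β.degree := by
          gcongr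
          rw [← div_eq_mul_inv, div_le_one hM0]
          linarith
      _ = _ := one_mul _
  refine ⟨u + 1, L, by linarith, hL0, fun α => (bound α).trans ?_⟩
  gcongr
  linarith

/-- The germ at the origin of a polynomial. -/
def polynomialGerm (n : ℕ) : MvPolynomial (Fin n) ℂ →ₐ[ℂ] convergentPowerSeries n where
  toFun F := ⟨(F : MvPowerSeries (Fin n) ℂ), isConvergent_coe F⟩
  map_one' := Subtype.ext MvPolynomial.coe_one
  map_mul' F G := Subtype.ext (MvPolynomial.coe_mul F G)
  map_zero' := Subtype.ext MvPolynomial.coe_zero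
  map_add' F G := Subtype.ext (MvPolynomial.coe_add F G)
  commutes' r := Subtype.ext (MvPolynomial.coe_C r)

theorem coe_polynomialGerm (F : MvPolynomial (Fin n) ℂ) :
    (polynomialGerm n F : MvPowerSeries (Fin n) ℂ) = F := rfl

theorem isUnit_of_constantCoeff_ne_zero (g : convergentPowerSeries n)
    (hg : MvPowerSeries.constantCoeff (g : MvPowerSeries (Fin n) ℂ) ≠ 0) : IsUnit g :=
  IsUnit.of_mul_eq_one ⟨(g : MvPowerSeries (Fin n) ℂ)⁻¹, g.2.inv⟩
    (Subtype.ext (MvPowerSeries.mul_inv_cancel _ hg))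

/-- The part of a power series consisting of the monomials whose first variable is `y_i`, divided
by `y_i`. -/
def firstVariableQuotient (i : Fin n) (g : MvPowerSeries (Fin n) ℂ) : MvPowerSeries (Fin n) ℂ :=
  fun β => if ∀ j < i, β j = 0 then MvPowerSeries.coeff (β + Finsupp.single i 1) g else 0

theorem coeff_firstVariableQuotient (i : Fin n) (g : MvPowerSeries (Fin n) ℂ) (β : Fin n →₀ ℕ) :
    MvPowerSeries.coeff β (firstVariableQuotient i g) =
      if ∀ j < i, β j = 0 then MvPowerSeries.coeff (β + Finsupp.single i 1) g else 0 := rfl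

theorem IsConvergent.firstVariableQuotient {g : MvPowerSeries (Fin n) ℂ} (hg : IsConvergent g)
    (i : Fin n) : IsConvergent (firstVariableQuotient i g) := by
  obtain ⟨C, K, hC, hK, H⟩ := hg
  refine ⟨C * K, K, by positivity, hK, fun α => ?_⟩
  rw [coeff_firstVariableQuotient]
  split_ifs
  · refine (H _).trans_eq ?_
    rw [map_add, Finsupp.degree_single, pow_succ]
    ring
  · rw [norm_zero]; positivity

/-- Each nonconstant monomial is counted once, at the least index of a variable dividing it. -/
theorem sum_X_mul_firstVariableQuotient {g : MvPowerSeries (Fin n) ℂ}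
    (hg : MvPowerSeries.coeff 0 g = 0) :
    ∑ i, MvPowerSeries.X i * firstVariableQuotient i g = g := by
  classical
  ext β
  rw [map_sum]
  have hterm : ∀ i, MvPowerSeries.coeff β (MvPowerSeries.X i * firstVariableQuotient i g) =
      if 1 ≤ β i ∧ ∀ j < i, β j = 0 then MvPowerSeries.coeff β g else 0 := by
    intro i
    rw [MvPowerSeries.X, MvPowerSeries.coeff_monomial_mul, one_mul, coeff_firstVariableQuotient]
    by_cases hi : 1 ≤ β i
    · have hle : Finsupp.single i 1 ≤ β := by simpa using hi
      rw [if_pos hle, tsub_add_cancel_of_le hle]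
      have : (∀ j < i, (β - Finsupp.single i 1 : Fin n →₀ ℕ) j = 0) ↔ ∀ j < i, β j = 0 := by
        refine forall₂_congr fun j hj => ?_
        simp [hj.ne']
      simp only [this, hi, true_and]
    · have hle : ¬ Finsupp.single i 1 ≤ β := by simpa using hi
      rw [if_neg hle, if_neg fun h => hi h.1]
  simp only [hterm]
  by_cases hβ : β = 0
  · subst hβ
    simp [hg]
  · have hex : ∃ i, β i ≠ 0 := Finsupp.ne_iff.mp hβ
    obtain ⟨i, hi, hmin⟩ : ∃ i, β i ≠ 0 ∧ ∀ j < i, β j = 0 := by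
      let s := Finset.univ.filter fun i => β i ≠ 0
      have hs : s.Nonempty := hex.imp fun i hi => by simpa [s] using hi
      refine ⟨s.min' hs, by simpa [s] using s.min'_mem hs, fun j hj => ?_⟩
      by_contra h
      exact absurd (s.min'_le j (by simpa [s] using h)) (not_le.mpr hj)
    rw [Finset.sum_eq_single i]
    · rw [if_pos ⟨Nat.one_le_iff_ne_zero.mpr hi, hmin⟩]
    · intro j _ hj
      rw [if_neg]
      rintro ⟨h1, h2⟩
      rcases lt_or_gt_of_ne hj with h | h
      · have := hmin j h; lia
      · exact hi (h2 i h)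
    · simp

/-- Germs of order at least `N` lie in the `N`-th power of the maximal ideal. -/
theorem mem_map_idealOfVars_pow (N : ℕ) (g : convergentPowerSeries n)
    (hg : ∀ α : Fin n →₀ ℕ, α.degree < N →
      MvPowerSeries.coeff α (g : MvPowerSeries (Fin n) ℂ) = 0) :
    g ∈ (idealOfVars (Fin n) ℂ).map (polynomialGerm n) ^ N := by
  induction N generalizing g with
  | zero => simp
  | succ N ih =>
    let q : Fin n → convergentPowerSeries n := fun i =>
      ⟨firstVariableQuotient i g, g.2.firstVariableQuotient i⟩
    have hsum : ∑ i, polynomialGerm n (X i) * q i = g := by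
      refine Subtype.ext ?_
      rw [AddSubmonoidClass.coe_finsetSum]
      simp only [MulMemClass.coe_mul, coe_polynomialGerm, MvPolynomial.coe_X, q]
      exact sum_X_mul_firstVariableQuotient (hg 0 (by simp))
    rw [← hsum, pow_succ']
    refine Ideal.sum_mem _ fun i _ => Ideal.mul_mem_mul
      (Ideal.mem_map_of_mem _ (Ideal.subset_span ⟨i, rfl⟩)) (ih _ fun α hα => ?_)
    change MvPowerSeries.coeff α (firstVariableQuotient i g) = 0
    rw [coeff_firstVariableQuotient]
    split_ifs
    · exact hg _ (by rw [map_add, Finsupp.degree_single]; lia)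
    · rfl

/-- The local ring of germs modulo an ideal generated by polynomials with an isolated zero at the
origin is a quotient of the polynomial ring. -/
theorem nonempty_quotient_map_polynomialGerm_equiv (I : Ideal (MvPolynomial (Fin n) ℂ))
    (h : MvPolynomial (Fin n) ℂ) (h0 : eval 0 h ≠ 0) (N : ℕ)
    (hN : ∀ F ∈ idealOfVars (Fin n) ℂ ^ N, h * F ∈ I) :
    Nonempty ((convergentPowerSeries n ⧸ I.map (polynomialGerm n)) ≃ₗ[ℂ]
      (MvPolynomial (Fin n) ℂ ⧸ I ⊔ idealOfVars (Fin n) ℂ ^ N)) := by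
  -- `h` becomes a unit among germs, so the factor `h` in `hN` can be cancelled.
  have hpow : (idealOfVars (Fin n) ℂ).map (polynomialGerm n) ^ N ≤ I.map (polynomialGerm n) := by
    rw [← Ideal.map_pow, Ideal.map_le_iff_le_comap]
    intro F hF
    have hunit : IsUnit (polynomialGerm n h) := isUnit_of_constantCoeff_ne_zero _ (by
      rw [coe_polynomialGerm, ← MvPowerSeries.coeff_zero_eq_constantCoeff_apply,
        MvPolynomial.coeff_coe, ← constantCoeff_eq, ← eval_zero]
      exact h0)
    rw [Ideal.mem_comap, ← Ideal.unit_mul_mem_iff_mem _ hunit, ← map_mul]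
    exact Ideal.mem_map_of_mem _ (hN F hF)
  let P := MvPolynomial (Fin n) ℂ
  let T : P →ₐ[ℂ] convergentPowerSeries n ⧸ I.map (polynomialGerm n) :=
    (Ideal.Quotient.mkₐ ℂ (I.map (polynomialGerm n))).comp (polynomialGerm n)
  -- Truncation below degree `N`. It kills the extension of `I`, so a polynomial whose germ lies in
  -- that extension lies in `I ⊔ idealOfVars (Fin n) ℂ ^ N`.
  let S : convergentPowerSeries n →+* P ⧸ I ⊔ idealOfVars (Fin n) ℂ ^ N :=
    ((Ideal.Quotient.factor (le_sup_right : idealOfVars (Fin n) ℂ ^ N ≤ I ⊔ _)).comp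
      (MvPowerSeries.truncTotalAlgHom (Fin n) ℂ N : MvPowerSeries (Fin n) ℂ →+* _)).comp
      (convergentPowerSeries n).val.toRingHom
  have hS : ∀ F, S (polynomialGerm n F) = Ideal.Quotient.mk _ F := by
    intro F
    have h1 := (MvPowerSeries.truncTotalAlgHom (Fin n) ℂ N).commutes F
    exact congrArg (Ideal.Quotient.factor
      (le_sup_right : idealOfVars (Fin n) ℂ ^ N ≤ I ⊔ _)) h1
  have hT : Function.Surjective T := by
    intro x
    obtain ⟨g, rfl⟩ := Ideal.Quotient.mk_surjective x
    refine ⟨MvPowerSeries.truncTotal N (g : MvPowerSeries (Fin n) ℂ), ?_⟩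
    refine (Ideal.Quotient.mk_eq_mk_iff_sub_mem _ _).mpr (hpow (mem_map_idealOfVars_pow N _ ?_))
    intro α hα
    change MvPowerSeries.coeff α (_ - _) = 0
    rw [map_sub]
    change MvPowerSeries.coeff α ((MvPowerSeries.truncTotal N (g : MvPowerSeries (Fin n) ℂ) :
      MvPolynomial (Fin n) ℂ) : MvPowerSeries (Fin n) ℂ) - _ = 0
    rw [MvPolynomial.coeff_coe, MvPowerSeries.coeff_truncTotal _ hα,
      sub_self]
  have hker : RingHom.ker T = I ⊔ idealOfVars (Fin n) ℂ ^ N := by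
    apply le_antisymm
    · intro F hF
      have h1 : polynomialGerm n F ∈ I.map (polynomialGerm n) :=
        Ideal.Quotient.eq_zero_iff_mem.mp hF
      have h2 : I.map (polynomialGerm n) ≤ RingHom.ker S := by
        rw [Ideal.map_le_iff_le_comap]
        intro G hG
        rw [Ideal.mem_comap, RingHom.mem_ker, hS]
        exact Ideal.Quotient.eq_zero_iff_mem.mpr (Ideal.mem_sup_left hG)
      have h3 := h2 h1
      rw [RingHom.mem_ker, hS] at h3
      exact Ideal.Quotient.eq_zero_iff_mem.mp h3
    · refine sup_le (fun F hF => ?_) fun F hF => ?_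
      · exact Ideal.Quotient.eq_zero_iff_mem.mpr (Ideal.mem_map_of_mem _ hF)
      · refine Ideal.Quotient.eq_zero_iff_mem.mpr (hpow ?_)
        rw [← Ideal.map_pow]
        exact Ideal.mem_map_of_mem _ hF
  rw [← hker]
  exact ⟨(Ideal.quotientKerAlgEquivOfSurjective hT).toLinearEquiv.symm⟩

theorem foldr_germPderiv_polynomialGerm (l : List (Fin n)) (F : MvPolynomial (Fin n) ℂ) :
    l.foldr germPderiv (polynomialGerm n F) =
      polynomialGerm n (l.foldr (fun i g => pderiv i g) F) := by
  induction l with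
  | nil => rfl
  | cons i l ih =>
    rw [List.foldr_cons, ih]
    exact Subtype.ext (MvPowerSeries.pderiv_coe _)

theorem tjurinaIdeal_polynomialGerm (k : ℕ) (F : MvPolynomial (Fin n) ℂ) :
    tjurinaIdeal k (polynomialGerm n F) = (polynomialTjurinaIdeal k F).map (polynomialGerm n) := by
  rw [polynomialTjurinaIdeal, Ideal.map_span, tjurinaIdeal]
  congr 1
  ext g
  constructor
  · rintro ⟨l, hl, rfl⟩
    exact ⟨_, ⟨l, hl, rfl⟩, (foldr_germPderiv_polynomialGerm l F).symm⟩
  · rintro ⟨_, ⟨l, hl, rfl⟩, rfl⟩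
    exact ⟨l, hl, (foldr_germPderiv_polynomialGerm l F).symm⟩

end Convergent

/-! ### Artinian graded quotients -/

section Artinian

variable {σ K : Type*} [Field K]

attribute [local instance] MvPolynomial.gradedAlgebra

theorem eval_smul_eq_zero_of_isHomogeneous {J : Ideal (MvPolynomial σ K)}
    (hJ : J.IsHomogeneous (homogeneousSubmodule σ K)) {v : σ → K}
    (hv : ∀ F ∈ J, eval v F = 0) (c : K) : ∀ F ∈ J, eval (c • v) F = 0 := by
  intro F hF
  rw [← sum_homogeneousComponent F, map_sum]
  refine Finset.sum_eq_zero fun i _ => ?_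
  rw [eval_smul_of_isHomogeneous (homogeneousComponent_isHomogeneous i F),
    hv _ (homogeneousComponent_mem_of_mem hJ hF i), mul_zero]

/-- Restriction of polynomial functions to the line spanned by `v`. -/
def restrictLine (v : σ → K) : MvPolynomial σ K →ₐ[K] Polynomial K :=
  aeval fun i => Polynomial.C (v i) * Polynomial.X

theorem eval_restrictLine (v : σ → K) (t : K) (F : MvPolynomial σ K) :
    (restrictLine v F).eval t = eval (t • v) F := by
  induction F using MvPolynomial.induction_on with
  | C r => simp [restrictLine]
  | add p q hp hq => simp only [map_add, Polynomial.eval_add, hp, hq]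
  | mul_X p i hp =>
    rw [map_mul, Polynomial.eval_mul, map_mul, hp]
    rw [restrictLine, aeval_X, eval_X, Polynomial.eval_mul, Polynomial.eval_C, Polynomial.eval_X,
      Pi.smul_apply, smul_eq_mul, mul_comm t]

theorem restrictLine_surjective {v : σ → K} (hv : v ≠ 0) :
    Function.Surjective (restrictLine v) := by
  obtain ⟨i, hi⟩ := Function.ne_iff.mp hv
  rw [Pi.zero_apply] at hi
  rw [← AlgHom.range_eq_top, ← top_le_iff, ← Polynomial.adjoin_X, Algebra.adjoin_le_iff,
    Set.singleton_subset_iff]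
  refine ⟨C (v i)⁻¹ * X i, ?_⟩
  simp only [restrictLine, AlgHom.toRingHom_eq_coe, RingHom.coe_coe, map_mul, aeval_C, aeval_X]
  rw [← Polynomial.C_eq_algebraMap, ← mul_assoc, ← Polynomial.C_mul, inv_mul_cancel₀ hi,
    Polynomial.C_1, one_mul]

/-- A graded quotient of the polynomial ring is Artinian iff it has no projective zeros. -/
theorem isArtinianRing_quotient_iff [IsAlgClosed K] [Finite σ] {J : Ideal (MvPolynomial σ K)}
    (hJ : J.IsHomogeneous (homogeneousSubmodule σ K)) :
    IsArtinianRing (MvPolynomial σ K ⧸ J) ↔ ∀ v : σ → K, v ≠ 0 → ¬ ∀ F ∈ J, eval v F = 0 := by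
  constructor
  · intro h v hv hzero
    have : Infinite K := IsAlgClosed.instInfinite
    -- A projective zero gives a whole line of zeros, hence a surjection of the quotient onto
    -- `K[t]`, a domain that is not a field.
    have hker : ∀ F ∈ J, (restrictLine v : MvPolynomial σ K →+* Polynomial K) F = 0 := by
      intro F hF
      refine Polynomial.funext fun t => ?_
      rw [Polynomial.eval_zero]
      exact (eval_restrictLine v t F).trans (eval_smul_eq_zero_of_isHomogeneous hJ hzero t F hF)
    have hsurj : Function.Surjective (Ideal.Quotient.lift J _ hker) :=
      Ideal.Quotient.lift_surjective_of_surjective J hker (restrictLine_surjective hv)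
    have hart : IsArtinianRing (Polynomial K) := hsurj.isArtinianRing
    exact Polynomial.not_isField K (IsArtinianRing.isField_of_isDomain _)
  · intro h
    obtain ⟨N, hN⟩ := exists_pow_idealOfVars_le (I := J) fun v hv => by
      by_contra hv0
      exact h v hv0 hv
    rw [isArtinianRing_iff_krullDimLE_zero, Ring.krullDimLE_zero_iff]
    intro P hP
    -- `J` contains a power of the ideal of the origin, so every prime over `J` contains this
    -- maximal ideal and equals it.
    have hle : vanishingIdeal K {(0 : σ → K)} ≤ P.comap (Ideal.Quotient.mk J) := by
      have h1 : idealOfVars σ K ≤ P.comap (Ideal.Quotient.mk J) := by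
        refine Ideal.IsPrime.le_of_pow_le (n := N) (hN.trans fun F hF => ?_)
        rw [Ideal.mem_comap, Ideal.Quotient.eq_zero_iff_mem.mpr hF]
        exact zero_mem _
      intro F hF
      refine h1 ((mem_idealOfVars_iff_eval F).mpr ?_)
      simpa using hF 0 rfl
    have hmax : (vanishingIdeal K {(0 : σ → K)}).IsMaximal := inferInstance
    have hmax' : (P.comap (Ideal.Quotient.mk J)).IsMaximal := by
      rwa [← hmax.eq_of_le (Ideal.IsPrime.ne_top inferInstance) hle]
    have := Ideal.map_eq_top_or_isMaximal_of_surjective (Ideal.Quotient.mk J)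
      Ideal.Quotient.mk_surjective hmax'
    rw [Ideal.map_comap_of_surjective (Ideal.Quotient.mk J) Ideal.Quotient.mk_surjective] at this
    exact this.resolve_left hP.ne_top

end Artinian

/-! ### Multiplicity and the zeros of the Jacobian ideal -/

section Multiplicity

variable {n d k : ℕ} {f : MvPolynomial (Fin (n + 1)) ℂ}

theorem coeff_foldr_pderiv_eq_zero {σ : Type*} {g : MvPolynomial σ ℂ}
    (hg : ∀ α : σ →₀ ℕ, α.degree ≤ k → coeff α g = 0) (l : List σ) (α : σ →₀ ℕ)
    (hα : α.degree + l.length ≤ k) : coeff α (l.foldr (fun i g => pderiv i g) g) = 0 := by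
  induction l generalizing α with
  | nil => exact hg α hα
  | cons i l ih =>
    rw [List.foldr_cons, coeff_pderiv, ih, zero_mul]
    rw [map_add, Finsupp.degree_single]
    rw [List.length_cons] at hα
    lia

theorem coeff_eq_zero_of_foldr_pderiv {σ : Type*} {g : MvPolynomial σ ℂ}
    (hg : ∀ l : List σ, l.length ≤ k → eval 0 (l.foldr (fun i g => pderiv i g) g) = 0)
    (α : σ →₀ ℕ) (hα : α.degree ≤ k) : coeff α g = 0 := by
  classical
  induction k generalizing g α with
  | zero =>
    have h0 : α = 0 := (Finsupp.degree_eq_zero_iff α).mp (by lia)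
    have := hg [] (by simp)
    rwa [h0, ← constantCoeff_eq, ← eval_zero]
  | succ k ih =>
    by_cases h0 : α = 0
    · have := hg [] (by simp)
      rwa [h0, ← constantCoeff_eq, ← eval_zero]
    · obtain ⟨i, hi⟩ := Finsupp.ne_iff.mp h0
      obtain ⟨β, rfl⟩ : ∃ β, α = β + Finsupp.single i 1 :=
        ⟨α - Finsupp.single i 1, (tsub_add_cancel_of_le (by
          simpa [Nat.one_le_iff_ne_zero] using hi)).symm⟩
      have h1 : coeff β (pderiv i g) = 0 := by
        refine ih (fun l hl => ?_) β (by rw [map_add, Finsupp.degree_single] at hα; lia)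
        -- `foldr` applies the last entry first, so appending `i` differentiates `g` by `∂_i` before
        -- the rest.
        have := hg (l ++ [i]) (by simp; lia)
        rwa [List.foldr_append] at this
      rw [coeff_pderiv] at h1
      refine (mul_eq_zero.mp h1).resolve_right ?_
      exact Nat.cast_add_one_ne_zero (β i)

theorem localGerm_eq_polynomialGerm (f : MvPolynomial (Fin (n + 1)) ℂ) (p : ProjSpace n) :
    localGerm f p = polynomialGerm n (localEquation f p) := rfl

theorem lt_hypersurfaceMultiplicity_iff (f : MvPolynomial (Fin (n + 1)) ℂ) (p : ProjSpace n)
    (k : ℕ) : (k : ℕ∞) < hypersurfaceMultiplicity f p ↔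
      ∀ α : Fin n →₀ ℕ, α.degree ≤ k → coeff α (localEquation f p) = 0 := by
  constructor
  · intro h α hα
    rw [← MvPolynomial.coeff_coe]
    refine MvPowerSeries.coeff_of_lt_order (lt_of_le_of_lt ?_ h)
    exact_mod_cast hα
  · intro h
    have : ((k + 1 : ℕ) : ℕ∞) ≤ hypersurfaceMultiplicity f p := by
      refine MvPowerSeries.nat_le_order fun α hα => ?_
      rw [localGerm_eq_polynomialGerm, coe_polynomialGerm, MvPolynomial.coeff_coe]
      exact h α (by lia)
    refine lt_of_lt_of_le ?_ this
    exact_mod_cast Nat.lt_succ_self k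

theorem map_jacobianIdeal_eq (hf : f.IsHomogeneous d) (hkd : k ≤ d) (p : ProjSpace n) :
    (jacobianIdeal k f).map (dehomogenize (chartIndex p)
      fun j => p.rep ((chartIndex p).succAbove j) / p.rep (chartIndex p)) =
        polynomialTjurinaIdeal k (localEquation f p) :=
  map_dehomogenize_jacobianIdeal hf hkd _ _

/-- The common zeros of the `k`-th order partial derivatives are the points of multiplicity larger
than `k`. -/
theorem lt_hypersurfaceMultiplicity_iff_jacobianIdeal (hf : f.IsHomogeneous d) (hkd : k ≤ d)
    (p : ProjSpace n) : (k : ℕ∞) < hypersurfaceMultiplicity f p ↔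
      ∀ F ∈ jacobianIdeal k f, eval p.rep F = 0 := by
  have hc := rep_chartIndex_ne_zero p
  have h1 : (∀ F ∈ jacobianIdeal k f, eval p.rep F = 0) ↔
      polynomialTjurinaIdeal k (localEquation f p) ≤ idealOfVars (Fin n) ℂ := by
    rw [← map_jacobianIdeal_eq hf hkd, Ideal.map_le_iff_le_comap]
    have h2 : ∀ F, F ∈ (idealOfVars (Fin n) ℂ).comap (dehomogenize (chartIndex p)
        fun j => p.rep ((chartIndex p).succAbove j) / p.rep (chartIndex p)) ↔
        eval ((p.rep (chartIndex p))⁻¹ • p.rep) F = 0 := fun F => by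
      rw [Ideal.mem_comap, mem_idealOfVars_iff_eval, eval_zero_dehomogenize _ hc]
    constructor
    · intro h F hF
      rw [h2]
      exact eval_smul_eq_zero_of_isHomogeneous (isHomogeneous_jacobianIdeal hf k) h _ F hF
    · intro h
      have := eval_smul_eq_zero_of_isHomogeneous (isHomogeneous_jacobianIdeal hf k)
        (fun F hF => (h2 F).mp (h hF)) (p.rep (chartIndex p))
      rwa [smul_inv_smul₀ hc] at this
  rw [h1, lt_hypersurfaceMultiplicity_iff, polynomialTjurinaIdeal, Ideal.span_le]
  constructor
  · rintro h _ ⟨l, hl, rfl⟩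
    rw [SetLike.mem_coe, mem_idealOfVars_iff_eval, eval_zero, constantCoeff_eq]
    exact coeff_foldr_pderiv_eq_zero h l 0 (by simpa using hl)
  · intro h
    refine coeff_eq_zero_of_foldr_pderiv fun l hl => ?_
    exact (mem_idealOfVars_iff_eval _).mp (h ⟨l, hl, rfl⟩)

theorem eval_eq_zero_of_jacobianIdeal (hf : f.IsHomogeneous d) (hkd : k ≤ d)
    {v : Fin (n + 1) → ℂ} (hv : ∀ F ∈ jacobianIdeal k f, eval v F = 0) : eval v f = 0 :=
  hv _ (foldr_pderiv_mem_jacobianIdeal hf hkd [] (Nat.zero_le _))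

theorem isArtinianRing_milnorAlgebra_iff (hf : f.IsHomogeneous d) (hkd : k ≤ d) :
    IsArtinianRing (MilnorAlgebra k f) ↔
      ∀ p ∈ hypersurface f, hypersurfaceMultiplicity f p ≤ (k : ℕ∞) := by
  have hJ := isHomogeneous_jacobianIdeal hf k
  rw [isArtinianRing_quotient_iff hJ]
  constructor
  · intro h p _
    rw [← not_lt, lt_hypersurfaceMultiplicity_iff_jacobianIdeal hf hkd]
    exact h p.rep p.rep_nonzero
  · intro h v hv hzero
    obtain ⟨u, hu⟩ := Projectivization.exists_smul_eq_mk_rep ℂ v hv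
    have hrep : ∀ F ∈ jacobianIdeal k f, eval (Projectivization.mk ℂ v hv).rep F = 0 := by
      rw [← hu]
      exact eval_smul_eq_zero_of_isHomogeneous hJ hzero (u : ℂ)
    -- The point lies on `V(f)` because `f` itself belongs to the Jacobian ideal.
    refine absurd (h _ (eval_eq_zero_of_jacobianIdeal hf hkd hrep)) ?_
    rwa [not_le, lt_hypersurfaceMultiplicity_iff_jacobianIdeal hf hkd]

end Multiplicity

/-! ### Local contributions as Tjurina numbers -/

section Tjurina

variable {n d k : ℕ} {f : MvPolynomial (Fin (n + 1)) ℂ}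

theorem exists_eq_smul_rep_of_jacobianIdeal (hf : f.IsHomogeneous d) (hkd : k ≤ d) (hk : 1 ≤ k)
    {ι : Type*} {p : ι → ProjSpace n} (hp : Set.range p = singularLocus f)
    (v : Fin (n + 1) → ℂ) (hv : v ≠ 0) (hzero : ∀ F ∈ jacobianIdeal k f, eval v F = 0) :
    ∃ i, ∃ c : ℂ, v = c • (p i).rep := by
  obtain ⟨u, hu⟩ := Projectivization.exists_smul_eq_mk_rep ℂ v hv
  have hrep : ∀ F ∈ jacobianIdeal k f, eval (Projectivization.mk ℂ v hv).rep F = 0 := by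
    rw [← hu]
    exact eval_smul_eq_zero_of_isHomogeneous (isHomogeneous_jacobianIdeal hf k) hzero (u : ℂ)
  have hmem : Projectivization.mk ℂ v hv ∈ Set.range p := by
    rw [hp]
    exact ⟨eval_eq_zero_of_jacobianIdeal hf hkd hrep, fun i =>
      hrep _ (foldr_pderiv_mem_jacobianIdeal hf hkd [i] hk)⟩
  obtain ⟨i, hi⟩ := hmem
  refine ⟨i, (u⁻¹ : ℂˣ), ?_⟩
  rw [hi, ← hu]
  exact (inv_smul_smul u v).symm

theorem smul_rep_ne {p q : ProjSpace n} (hpq : p ≠ q) (c : ℂ) : c • p.rep ≠ q.rep := by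
  intro h
  refine hpq ?_
  rw [← p.mk_rep, ← q.mk_rep, eq_comm, Projectivization.mk_eq_mk_iff']
  exact ⟨c, h⟩

/-- Near each of finitely many points containing all the zeros of `J`, the ideal `J` has at most an
isolated zero. -/
theorem exists_mul_mem_map_dehomogenize {J : Ideal (MvPolynomial (Fin (n + 1)) ℂ)}
    {ι : Type*} [Fintype ι] (a : ι → Fin (n + 1) → ℂ) (ha : ∀ i, a i ≠ 0)
    (hne : ∀ i j, i ≠ j → ∀ c : ℂ, c • a i ≠ a j)
    (hzero : ∀ v : Fin (n + 1) → ℂ, v ≠ 0 → (∀ F ∈ J, eval v F = 0) → ∃ i, ∃ c : ℂ, v = c • a i)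
    (i : ι) (c : Fin (n + 1)) (hc : a i c ≠ 0) :
    ∃ (N : ℕ) (h : MvPolynomial (Fin n) ℂ), eval 0 h ≠ 0 ∧ ∀ F ∈ idealOfVars (Fin n) ℂ ^ N,
      h * F ∈ J.map (dehomogenize c fun j => a i (c.succAbove j) / a i c) := by
  classical
  -- The product `H` of these vanishes at every other point but not at `a i`; a power of it,
  -- dehomogenized, is the local unit `h`.
  have hex : ∀ j, ∃ F : MvPolynomial (Fin (n + 1)) ℂ,
      (j ≠ i → F ∈ pointIdeal (a j)) ∧ eval ((a i c)⁻¹ • a i) F ≠ 0 := by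
    intro j
    by_cases hj : j = i
    · exact ⟨1, fun h => absurd hj h, by simp⟩
    · by_contra! hF
      obtain ⟨t, ht⟩ := exists_eq_smul_of_pointIdeal (v := (a i c)⁻¹ • a i) (ha j)
        fun F h => hF F fun _ => h
      refine hne j i hj (a i c * t) ?_
      rw [mul_smul, ← ht, smul_inv_smul₀ hc]
  choose G hG hG0 using hex
  set H := ∏ j, G j with hH
  -- On the zeros of `J`, `H` handles the points other than `a i`, and the point ideal handles `a i`
  -- and the origin.
  obtain ⟨N, hN⟩ := exists_pow_le_of_forall_zero (I := J) (J := Ideal.span {H} * pointIdeal (a i))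
    fun v hv F hF => by
      have hF₁ : F ∈ Ideal.span {H} := Ideal.mul_le_left hF
      have hF₂ : F ∈ pointIdeal (a i) := Ideal.mul_le_right hF
      by_cases hv0 : v = 0
      · rw [hv0, ← zero_smul ℂ (a i)]
        exact eval_smul_eq_zero_of_pointIdeal _ _ hF₂
      obtain ⟨j, t, rfl⟩ := hzero v hv0 hv
      by_cases hj : j = i
      · subst hj
        exact eval_smul_eq_zero_of_pointIdeal _ _ hF₂
      · obtain ⟨q, hq⟩ := Ideal.mem_span_singleton.mp hF₁
        rw [hq, map_mul, hH, map_prod, Finset.prod_eq_zero (Finset.mem_univ j)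
          (eval_smul_eq_zero_of_pointIdeal _ _ (hG j hj)), zero_mul]
  refine ⟨N, dehomogenize c (fun j => a i (c.succAbove j) / a i c) (H ^ N), ?_, fun F hF => ?_⟩
  · rw [eval_zero_dehomogenize c hc, map_pow, hH, map_prod]
    exact pow_ne_zero _ (Finset.prod_ne_zero_iff.mpr fun j _ => hG0 j)
  · rw [← map_dehomogenize_pointIdeal c hc, ← Ideal.map_pow,
      Ideal.mem_map_iff_of_surjective _ (dehomogenize_surjective _ _)] at hF
    obtain ⟨F, hF, rfl⟩ := hF
    rw [← map_mul]
    refine Ideal.mem_map_of_mem _ (hN ?_)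
    rw [mul_pow, Ideal.span_singleton_pow]
    exact Ideal.mul_mem_mul (Ideal.mem_span_singleton_self _) hF

theorem nonempty_quotient_equiv_tjurinaAlgebra (hf : f.IsHomogeneous d) (hkd : k ≤ d)
    (p : ProjSpace n) (N : ℕ) (h : MvPolynomial (Fin n) ℂ) (h0 : eval 0 h ≠ 0)
    (hN : ∀ F ∈ idealOfVars (Fin n) ℂ ^ N,
      h * F ∈ polynomialTjurinaIdeal k (localEquation f p)) :
    Nonempty ((MvPolynomial (Fin (n + 1)) ℂ ⧸
      jacobianIdeal k f ⊔ pointIdeal p.rep ^ N ⊔ Ideal.span {X (chartIndex p) - 1}) ≃ₗ[ℂ]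
        TjurinaAlgebra k (localGerm f p)) := by
  obtain ⟨e₁⟩ := nonempty_quotient_map_polynomialGerm_equiv _ h h0 N hN
  obtain ⟨e₂⟩ := nonempty_quotient_sup_X_sub_one_equiv (chartIndex p)
    (fun j => p.rep ((chartIndex p).succAbove j) / p.rep (chartIndex p))
    (jacobianIdeal k f ⊔ pointIdeal p.rep ^ N)
  rw [Ideal.map_sup, Ideal.map_pow, map_dehomogenize_pointIdeal _ (rep_chartIndex_ne_zero p),
    map_jacobianIdeal_eq hf hkd] at e₂
  rw [← tjurinaIdeal_polynomialGerm] at e₁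
  exact ⟨e₂.trans e₁.symm⟩

theorem exists_finrank_milnorPiece_eq_sum (hf : f.IsHomogeneous d) (hkd : k ≤ d) (hk : 1 ≤ k)
    {ι : Type*} [Fintype ι] {p : ι → ProjSpace n} (hinj : Function.Injective p)
    (hp : Set.range p = singularLocus f) :
    (∀ i, Module.Finite ℂ (TjurinaAlgebra k (localGerm f (p i)))) ∧
      ∃ m₀ : ℕ, ∀ m ≥ m₀,
        Module.finrank ℂ (milnorPiece k f m) = ∑ i, tjurinaNumber k f (p i) := by
  have hJ := isHomogeneous_jacobianIdeal hf k
  have hzero := exists_eq_smul_rep_of_jacobianIdeal hf hkd hk hp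
  have hne : ∀ i j, i ≠ j → ∀ c : ℂ, c • (p i).rep ≠ (p j).rep := fun i j hij =>
    smul_rep_ne (hinj.ne hij)
  have hX : ∀ i, (X (chartIndex (p i)) : MvPolynomial (Fin (n + 1)) ℂ).IsHomogeneous 1 :=
    fun i => isHomogeneous_X _ _
  have hX0 : ∀ i, eval (p i).rep (X (chartIndex (p i))) ≠ 0 := fun i => by
    rw [eval_X]; exact rep_chartIndex_ne_zero _
  obtain ⟨N₀, hN₀⟩ := exists_finrank_piece_eq_sum hJ (fun i => (p i).rep)
    (fun i => (p i).rep_nonzero) (fun i j hij c _ => hne i j hij c) hzero _ hX hX0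
  choose M h h0 hM using fun i => exists_mul_mem_map_dehomogenize (fun i => (p i).rep)
    (fun i => (p i).rep_nonzero) hne hzero i (chartIndex (p i)) (rep_chartIndex_ne_zero (p i))
  -- One exponent serves both the global splitting and the comparison with germs at every point.
  set N := max N₀ (Finset.univ.sup M) with hN
  have hequiv := fun i => nonempty_quotient_equiv_tjurinaAlgebra hf hkd (p i) N (h i) (h0 i)
    fun F hF => by
      rw [← map_jacobianIdeal_eq hf hkd]
      exact hM i F (Ideal.pow_le_pow_right
        ((Finset.le_sup (Finset.mem_univ i)).trans (le_max_right _ _)) hF)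
  constructor
  · intro i
    have := (finrank_sup_pointIdeal_pow hJ (p i).rep_nonzero N (hX i) (hX0 i)).1
    exact Module.Finite.equiv (hequiv i).some
  · obtain ⟨m₀, hm₀⟩ := hN₀ N (le_max_left _ _)
    refine ⟨m₀, fun m hm => (hm₀ m hm).trans (Finset.sum_congr rfl fun i _ => ?_)⟩
    exact (hequiv i).some.finrank_eq

end Tjurina

end HigherMilnor

end

theorem theorem3p2 (n d k : ℕ) (f : MvPolynomial (Fin (n + 1)) ℂ)
    (hf : f.IsHomogeneous d) (hred : Squarefree f) (hkd : k ≤ d) :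
    (IsArtinianRing (HigherMilnor.MilnorAlgebra k f) ↔
      ∀ p ∈ HigherMilnor.hypersurface f, HigherMilnor.hypersurfaceMultiplicity f p ≤ (k : ℕ∞)) ∧
    (1 ≤ k → ∀ (s : ℕ) (p : Fin s → HigherMilnor.ProjSpace n), Function.Injective p →
      Set.range p = HigherMilnor.singularLocus f →
        (∀ i, Module.Finite ℂ (HigherMilnor.TjurinaAlgebra k (HigherMilnor.localGerm f (p i)))) ∧
        ∃ m₀ : ℕ, ∀ m ≥ m₀,
          Module.finrank ℂ (HigherMilnor.milnorPiece k f m) =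
            ∑ i, HigherMilnor.tjurinaNumber k f (p i)) :=
  ⟨HigherMilnor.isArtinianRing_milnorAlgebra_iff hf hkd, fun hk _ _ hinj hp =>
    HigherMilnor.exists_finrank_milnorPiece_eq_sum hf hkd hk hinj hp⟩
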